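/- Let $p\neq\ell$ be primes, let $K$ be a finite extension of $\mathbb{Q}_\ell$ with Weil group $W_K$ and inertia subgroup $I_K$, and let $q$ be the cardinality of the residue field of $\mathcal{O}_K$. Let $v_K:W_K\to\mathbb{Z}$ be the homomorphism that is trivial on $I_K$ and sends the geometric Frobenius to $1$. Fix $\varphi\in W_K$ with $v_K(\varphi)=1$ and a square root $q^{1/2}\in\overline{\mathbb{Q}}_p$ of $q$, and let $\psi:W_K\to\overline{\mathbb{Q}}_p^\times$, $\psi(g)=(q^{1/2})^{v_K(g)}$, be the unramified character sending the geometric Frobenius to $q^{1/2}$. A Weil–Deligne representation of $W_K$ on a finite dimensional $\overline{\mathbb{Q}}_p$-vector space $V$ is a pair $(\rho,N)$ of a linear representation $\rho$ of $W_K$ on $V$ with open kernel and a nilpotent operator $N$ on $V$ such that $\rho(\sigma)N\rho(\sigma)^{-1}=q^{-v_K(\sigma)}N$ for all $\sigma\in W_K$. Its monodromy filtration is $M_k=\sum_{i-j=k,\ i,j\ge 0}\ker N^{i+1}\cap N^{j}V$ ($k\in\mathbb{Z}$). For $w\in\mathbb{Z}$ it is pure of weight $w$ if for every $i\in\mathbb{Z}$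 all eigenvalues of $\rho(\varphi)$ on $M_i/M_{i-1}$ are $q$-Weil numbers of weight $w+i$, i.e. algebraic over $\mathbb{Q}$ with all complex conjugates of absolute value $q^{(w+i)/2}$; its normalized trace is then the function $g\mapsto\operatorname{tr}\big(\psi^{-w}(g)\rho(g)\big)$ on $W_K$. Its Frobenius-semisimplification is $(\rho,N)^{\mathrm{Fr\text{-}ss}}=(\widetilde\rho,N)$, where $\widetilde\rho(g)=\rho(g)u^{-v_K(g)}$ and $u$ is the unipotent part of $\rho(\varphi)$. For $n\in\mathbb{Z}$ put $\psi^n\otimes(\rho,N)=(\psi^n\rho,N)$. An isomorphism of Weil–Deligne representations is a linear isomorphism commuting with the actions of $W_K$ and with the monodromy operators. **Theorem.** Let $(\rho_1,N_1)$ and $(\rho_2,N_2)$ be Weil–Deligne representations of $W_K$ on finite dimensional $\overline{\mathbb{Q}}_p$-vector spaces that are pure of weights $w_1$ and $w_2$ respectively. If their normalized traces are equal, then $$(\rho_1,N_1)^{\mathrm{Fr\text{-}ss}}\;\cong\;\psi^{\,w_1-w_2}\otimes(\rho_2,N_2)^{\mathrm{Fr\text{-}ss}}.$$ -/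

import Mathlib

noncomputable section

namespace LocalField

open IsLocalRing
open scoped Topology

universe u

/-! ### Multiplicative Jordan decomposition -/

section LinearAlgebra
variable {F V : Type*} [Field F] [AddCommGroup V] [Module F V]

theorem isNilpotent_mul_sub_one {A : Type*} [Ring A] {a b : A} (h : Commute a b)
    (ha : IsNilpotent (a - 1)) (hb : IsNilpotent (b - 1)) : IsNilpotent (a * b - 1) := by
  have e : a * b - 1 = (a - 1) * b + (b - 1) := by noncomm_ring
  rw [e]
  have h1 : Commute (a - 1) b := h.sub_left (Commute.one_left b)
  refine Commute.isNilpotent_add ?_ (h1.isNilpotent_mul_right ha) hb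
  exact ((h1.sub_right (Commute.one_right _)).mul_left
    ((Commute.refl b).sub_right (Commute.one_right _)))

theorem isNilpotent_pow_sub_one {A : Type*} [Ring A] {a : A}
    (ha : IsNilpotent (a - 1)) (n : ℕ) : IsNilpotent (a ^ n - 1) := by
  induction n with
  | zero => simp
  | succ n ih => rw [pow_succ]; exact isNilpotent_mul_sub_one (Commute.pow_self a n) ih ha

theorem commute_of_commute_pow [CharZero F] {u T : Module.End F V} (hu : IsNilpotent (u - 1))
    {n : ℕ} (hn : 0 < n) (h : Commute T (u ^ n)) : Commute T u := by
  set A : Module.End F (Module.End F V) := LinearMap.mulLeft F u with hA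
  set B : Module.End F (Module.End F V) := LinearMap.mulRight F u with hB
  have hAB : Commute A B := LinearMap.commute_mulLeft_right u u
  have hA1 : IsNilpotent (A - 1) := by
    have : A - 1 = LinearMap.mulLeft F (u - 1) := by ext x; simp [hA, sub_mul]
    rw [this, LinearMap.isNilpotent_mulLeft_iff]; exact hu
  have hB1 : IsNilpotent (B - 1) := by
    have : B - 1 = LinearMap.mulRight F (u - 1) := by ext x; simp [hB, mul_sub]
    rw [this, LinearMap.isNilpotent_mulRight_iff]; exact hu
  have hS : IsUnit (∑ i ∈ Finset.range n, A ^ i * B ^ (n - 1 - i)) := by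
    have hnil : IsNilpotent (∑ i ∈ Finset.range n, (A ^ i * B ^ (n - 1 - i) - 1)) := by
      refine Commute.isNilpotent_sum (fun i _ => ?_) (fun i j _ _ => ?_)
      · exact isNilpotent_mul_sub_one (hAB.pow_pow _ _) (isNilpotent_pow_sub_one hA1 _)
          (isNilpotent_pow_sub_one hB1 _)
      · have key : ∀ a b c d : ℕ, Commute (A ^ a * B ^ b) (A ^ c * B ^ d) := fun a b c d =>
          Commute.mul_left
            (Commute.mul_right (Commute.pow_pow_self A a c) (hAB.pow_pow a d))
            (Commute.mul_right (hAB.symm.pow_pow b c) (Commute.pow_pow_self B b d))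
        exact ((key _ _ _ _).sub_right (Commute.one_right _)).sub_left
          ((Commute.one_left _).sub_right (Commute.one_right _))
    have hu1 : IsUnit (algebraMap F (Module.End F (Module.End F V)) (n : F)) :=
      (IsUnit.mk0 (n : F) (by exact_mod_cast hn.ne')).map _
    have := hnil.isUnit_add_left_of_commute hu1 (Algebra.commute_algebraMap_right _ _)
    simpa using this
  have h0 : (A ^ n - B ^ n) T = 0 := by
    rw [hA, hB, LinearMap.pow_mulLeft, LinearMap.pow_mulRight]
    simp [h.eq]
  have hc := hAB.geom_sum₂_mul n
  have hc' : Commute (∑ i ∈ Finset.range n, A ^ i * B ^ (n - 1 - i)) (A - B) := by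
    refine Commute.sum_left _ _ _ fun i _ => ?_
    exact Commute.sub_right
      (((Commute.refl A).pow_left i).mul_left (hAB.symm.pow_left _))
      ((hAB.pow_left i).mul_left ((Commute.refl B).pow_left _))
  rw [← hc] at h0
  obtain ⟨v, hv⟩ := hS
  rw [← hv, Module.End.mul_apply] at h0
  have h2 : (A - B) T = 0 := by
    have := congrArg (↑v⁻¹ : Module.End F (Module.End F V)) h0
    rwa [map_zero, ← Module.End.mul_apply, Units.inv_mul, Module.End.one_apply] at this
  have h3 : u * T - T * u = 0 := by simpa [hA, hB] using h2
  exact (sub_eq_zero.1 h3).symm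

variable [FiniteDimensional F V]

/-- The multiplicative Jordan decomposition `f = s u = u s` with `s` semisimple, `u` unipotent. -/
theorem exists_unipotent_semisimple [PerfectField F] (f : (Module.End F V)ˣ) :
    ∃ u s : (Module.End F V)ˣ, f = s * u ∧ Commute s u ∧
      (s : Module.End F V).IsSemisimple ∧ IsNilpotent ((u : Module.End F V) - 1) := by
  obtain ⟨f₀, hf₀⟩ : ∃ f₀ : Module.End F V, f₀ = f := ⟨_, rfl⟩
  obtain ⟨n, hn, s, hs, hnn, hss, hf⟩ := f₀.exists_isNilpotent_isSemisimple
  have hsf : Commute s f₀ := (Algebra.commute_of_mem_adjoin_singleton_of_commute hs (Commute.refl f₀)).symm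
  have hnf : Commute n f₀ := (Algebra.commute_of_mem_adjoin_singleton_of_commute hn (Commute.refl f₀)).symm
  have hs' : s = f₀ + -n := by rw [hf, add_neg_cancel_comm]
  have hsu : IsUnit s := by
    rw [hs']
    exact IsNilpotent.isUnit_add_left_of_commute hnn.neg (hf₀ ▸ f.isUnit) hnf.neg_left
  have hsn : Commute s n := by
    rw [hs']; exact hnf.symm.add_left (Commute.refl n).neg_left
  obtain ⟨s₁, hs₁⟩ := hsu
  have hc : Commute s₁ f := Units.ext (by rw [Units.val_mul, Units.val_mul, hs₁, ← hf₀]; exact hsf)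
  refine ⟨s₁⁻¹ * f, s₁, (mul_inv_cancel_left s₁ f).symm,
    ((Commute.refl s₁).inv_right).mul_right hc, hs₁ ▸ hss, ?_⟩
  have e : ((s₁⁻¹ * f : (Module.End F V)ˣ) : Module.End F V) - 1 = ↑s₁⁻¹ * n := by
    rw [Units.val_mul, ← hf₀, hf, mul_add, ← hs₁, Units.inv_mul, add_sub_cancel_right]
  rw [e]
  rw [← hs₁] at hsn
  exact (Commute.units_inv_left hsn).isNilpotent_mul_left hnn

/-- What commutes with a power of `s u` commutes with the unipotent part `u`. -/
theorem commute_unipotent_of_commute_pow [PerfectField F] [CharZero F] {s u T : Module.End F V}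
    (hsu : Commute s u) (hs : s.IsSemisimple) (hu : IsNilpotent (u - 1)) {n : ℕ} (hn : 0 < n)
    (hT : Commute T ((s * u) ^ n)) (hsunit : IsUnit s) : Commute T u := by
  refine commute_of_commute_pow hu hn ?_
  obtain ⟨m, hm, s', hs', hmm, hss', hf⟩ := ((s * u) ^ n).exists_isNilpotent_isSemisimple
  have hdec : s ^ n * (u ^ n - 1) + s ^ n = m + s' := by
    rw [← hf, hsu.mul_pow]; noncomm_ring
  have hpp : Commute (s ^ n) (u ^ n - 1) :=
    (hsu.pow_pow n n).sub_right (Commute.one_right _)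
  have huniq := Module.End.isNilpotent_isSemisimple_unique
    (hpp.isNilpotent_mul_left (isNilpotent_pow_sub_one hu n)) (hs.pow n) hmm hss'
    (((Commute.refl _).mul_left hpp.symm))
    (Algebra.commute_of_mem_adjoin_singleton_of_commute hm
      (Algebra.commute_of_mem_adjoin_self hs').symm).symm hdec
  have hTs : Commute T (s ^ n) := by
    rw [huniq.2]
    exact (Algebra.commute_of_mem_adjoin_singleton_of_commute hs' hT.symm.symm)
  obtain ⟨v, hv⟩ := hsunit.pow n
  rw [hsu.mul_pow, ← hv] at hT
  rw [← hv] at hTs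
  have : u ^ n = ↑v⁻¹ * (↑v * u ^ n) := by rw [Units.inv_mul_cancel_left]
  rw [this]
  exact (Commute.units_inv_right hTs).mul_right hT

/-- If `f N = c N f` then the unipotent part of `f` commutes with `N`. -/
theorem commute_unipotent_of_smul [IsAlgClosed F] {s u N : Module.End F V}
    (hsu : Commute s u) (hs : s.IsSemisimple) (hu : IsNilpotent (u - 1)) (hsunit : IsUnit s)
    {c : F} (hN : (s * u) * N = c • (N * (s * u))) : Commute u N := by
  have hgen : ∀ (a : F) (k : ℕ), (s * u - algebraMap F _ (c * a)) ^ k * N =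
      c ^ k • (N * (s * u - algebraMap F _ a) ^ k) := by
    intro a k
    induction k with
    | zero => simp
    | succ k ih =>
      have h1 : (s * u - algebraMap F _ (c * a)) * N = c • (N * (s * u - algebraMap F _ a)) := by
        rw [sub_mul, hN, mul_sub, smul_sub, Algebra.algebraMap_eq_smul_one,
          Algebra.algebraMap_eq_smul_one]
        simp [mul_smul]
      rw [pow_succ, mul_assoc, h1, mul_smul_comm, ← mul_assoc, ih, smul_mul_assoc, smul_smul,
        mul_assoc, ← pow_succ, ← pow_succ']
  have hnil : IsNilpotent (s * u - s) := by
    have : s * u - s = s * (u - 1) := by noncomm_ring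
    rw [this]
    exact (hsu.sub_right (Commute.one_right _)).isNilpotent_mul_left hu
  have hcs : Commute (s * u) s := (Commute.refl s).mul_left hsu.symm
  have hsN : s * N = c • (N * s) := by
    refine LinearMap.ext fun x => ?_
    have hx : x ∈ ⨆ μ : F, s.eigenspace μ := by rw [hs.iSup_eigenspace_eq_top]; trivial
    induction hx using Submodule.iSup_induction' with
    | zero => simp
    | add x y _ _ hx hy => simp only [map_add, hx, hy]
    | mem a x hx =>
      have hxs : s x = a • x := Module.End.mem_eigenspace_iff.1 hx
      obtain ⟨k, hk⟩ := hnil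
      have hfx : ((s * u - algebraMap F _ a) ^ k) x = 0 := by
        have h1 : ∀ j : ℕ, ((s * u - algebraMap F _ a) ^ j) x = ((s * u - s) ^ j) x := by
          intro j
          induction j with
          | zero => rfl
          | succ j ih =>
            have h2 : (s * u - algebraMap F _ a) x = (s * u - s) x := by
              simp [hxs, Algebra.algebraMap_eq_smul_one]
            have h3 : Commute ((s * u - algebraMap F _ a) ^ j) (s * u - s) := by
              refine Commute.pow_left ?_ j
              exact ((Commute.refl (s * u)).sub_right hcs).sub_left
                (Algebra.commute_algebraMap_left _ _)
            rw [pow_succ, Module.End.mul_apply, h2, ← Module.End.mul_apply, h3.eq,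
              Module.End.mul_apply, ih, ← Module.End.mul_apply, ← pow_succ']
        rw [h1, hk]; rfl
      have hNx : N x ∈ (s * u).maxGenEigenspace (c * a) := by
        rw [Module.End.mem_maxGenEigenspace]
        refine ⟨k, ?_⟩
        have := LinearMap.congr_fun (hgen a k) x
        rw [Algebra.algebraMap_eq_smul_one, Module.End.mul_apply] at this
        rw [this]; simp [hfx]
      have := Module.End.apply_eq_of_mem_of_comm_of_isFinitelySemisimple_of_isNil hNx hcs
        hs.isFinitelySemisimple ⟨k, hk⟩
      simp [this, hxs, mul_smul]
  obtain ⟨v, rfl⟩ := hsunit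
  have h1 : (v : Module.End F V) * (u * N) = v * (N * u) := by
    rw [← mul_assoc, hN, ← mul_assoc (v : Module.End F V) N u, hsN, smul_mul_assoc, mul_assoc]
  exact v.isUnit.mul_left_cancel h1
end LinearAlgebra

/-! ### The Weil group of a finite extension of `ℚ_ℓ` -/

section Arithmetic

variable (ℓ : ℕ) [Fact ℓ.Prime] (K : Type u) [Field K] [Algebra ℚ_[ℓ] K]

/-- The ring of integers `𝒪_K`: the integral closure of `ℤ_ℓ` in `K`. -/
def IntegerRing : Type u := integralClosure (PadicInt.subring ℓ) K
instance : CommRing (IntegerRing ℓ K) :=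
  inferInstanceAs (CommRing (integralClosure (PadicInt.subring ℓ) K))
instance : IsDomain (IntegerRing ℓ K) :=
  inferInstanceAs (IsDomain (integralClosure (PadicInt.subring ℓ) K))
instance : Algebra (PadicInt.subring ℓ) (IntegerRing ℓ K) :=
  inferInstanceAs (Algebra _ (integralClosure (PadicInt.subring ℓ) K))
instance : Algebra (IntegerRing ℓ K) K :=
  inferInstanceAs (Algebra (integralClosure (PadicInt.subring ℓ) K) K)
instance : FaithfulSMul (IntegerRing ℓ K) K :=
  inferInstanceAs (FaithfulSMul (integralClosure (PadicInt.subring ℓ) K) K)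
instance : IsScalarTower (PadicInt.subring ℓ) (IntegerRing ℓ K) K :=
  inferInstanceAs (IsScalarTower _ (integralClosure (PadicInt.subring ℓ) K) K)
instance : IsIntegralClosure (IntegerRing ℓ K) (PadicInt.subring ℓ) K :=
  inferInstanceAs (IsIntegralClosure (integralClosure (PadicInt.subring ℓ) K) _ K)
instance : Algebra.IsIntegral (PadicInt.subring ℓ) (IntegerRing ℓ K) :=
  inferInstanceAs (Algebra.IsIntegral _ (integralClosure (PadicInt.subring ℓ) K))

/-- The ring of integers of the algebraic closure of `K`. -/
def IntegerRingBar : Type u := integralClosure (IntegerRing ℓ K) (AlgebraicClosure K)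
instance : CommRing (IntegerRingBar ℓ K) :=
  inferInstanceAs (CommRing (integralClosure (IntegerRing ℓ K) (AlgebraicClosure K)))
instance : IsDomain (IntegerRingBar ℓ K) :=
  inferInstanceAs (IsDomain (integralClosure (IntegerRing ℓ K) (AlgebraicClosure K)))
instance : Algebra (IntegerRing ℓ K) (IntegerRingBar ℓ K) :=
  inferInstanceAs (Algebra _ (integralClosure (IntegerRing ℓ K) (AlgebraicClosure K)))
instance : FaithfulSMul (IntegerRing ℓ K) (AlgebraicClosure K) := by
  rw [faithfulSMul_iff_algebraMap_injective,
    IsScalarTower.algebraMap_eq (IntegerRing ℓ K) K (AlgebraicClosure K)]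
  exact (algebraMap K (AlgebraicClosure K)).injective.comp
    (FaithfulSMul.algebraMap_injective (IntegerRing ℓ K) K)
instance : FaithfulSMul (IntegerRing ℓ K) (IntegerRingBar ℓ K) := by
  rw [faithfulSMul_iff_algebraMap_injective]
  intro x y h
  exact FaithfulSMul.algebraMap_injective (IntegerRing ℓ K) (AlgebraicClosure K)
    (congrArg Subtype.val h)
instance : Algebra.IsIntegral (IntegerRing ℓ K) (IntegerRingBar ℓ K) :=
  inferInstanceAs (Algebra.IsIntegral _ (integralClosure (IntegerRing ℓ K) (AlgebraicClosure K)))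
instance : SMulCommClass Gal(AlgebraicClosure K/K) (IntegerRing ℓ K) (AlgebraicClosure K) where
  smul_comm g a x := by
    rw [Algebra.smul_def, Algebra.smul_def, smul_mul']
    congr 1
    rw [IsScalarTower.algebraMap_apply (IntegerRing ℓ K) K (AlgebraicClosure K)]
    exact g.commutes _
instance : MulSemiringAction Gal(AlgebraicClosure K/K) (IntegerRingBar ℓ K) :=
  inferInstanceAs (MulSemiringAction _ (integralClosure (IntegerRing ℓ K) (AlgebraicClosure K)))
instance : SMulCommClass Gal(AlgebraicClosure K/K) (IntegerRing ℓ K) (IntegerRingBar ℓ K) :=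
  inferInstanceAs (SMulCommClass _ _ (integralClosure (IntegerRing ℓ K) (AlgebraicClosure K)))
section
variable {ℓ} {L : Type u} [Field L] [Algebra ℚ_[ℓ] L] [Algebra.IsAlgebraic ℚ_[ℓ] L]

/-- A field extension of `ℚ_ℓ` is an algebra over `ℤ_ℓ`. -/
abbrev padicIntAlgebra (ℓ : ℕ) [Fact ℓ.Prime] (L : Type u) [Field L] [Algebra ℚ_[ℓ] L] :
    Algebra (PadicInt.subring ℓ) L := inferInstance

theorem isIntegral_iff_spectralNorm_le_one (x : L) :
    IsIntegral (PadicInt.subring ℓ) x ↔ spectralNorm ℚ_[ℓ] L x ≤ 1 := by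
  have hx : IsIntegral ℚ_[ℓ] x := Algebra.IsIntegral.isIntegral x
  rw [spectralNorm, spectralValue_le_one_iff (minpoly.monic hx)]
  have : IsIntegrallyClosed (PadicInt.subring ℓ) :=
    inferInstanceAs (IsIntegrallyClosed ℤ_[ℓ])
  have : IsFractionRing (PadicInt.subring ℓ) ℚ_[ℓ] :=
    inferInstanceAs (IsFractionRing ℤ_[ℓ] ℚ_[ℓ])
  constructor
  · intro h n
    rw [show minpoly ℚ_[ℓ] x = _ from minpoly.isIntegrallyClosed_eq_field_fractions ℚ_[ℓ] L h,
      Polynomial.coeff_map]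
    exact ((minpoly (PadicInt.subring ℓ) x).coeff n).2
  · intro h
    have hl : minpoly ℚ_[ℓ] x ∈ Polynomial.lifts (algebraMap (PadicInt.subring ℓ) ℚ_[ℓ]) := by
      rw [Polynomial.lifts_iff_coeff_lifts]
      exact fun n => ⟨⟨_, h n⟩, rfl⟩
    obtain ⟨P, hP, -, hm⟩ := Polynomial.lifts_and_degree_eq_and_monic hl (minpoly.monic hx)
    refine ⟨P, hm, ?_⟩
    have := minpoly.aeval ℚ_[ℓ] x
    rw [← hP, Polynomial.aeval_map_algebraMap] at this
    exact this

theorem isLocalRing_of_mem_iff (A : Subring L)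
    (hA : ∀ x, x ∈ A ↔ IsIntegral (PadicInt.subring ℓ) x) : IsLocalRing A := by
  simp only [isIntegral_iff_spectralNorm_le_one] at hA
  have hmul := fun x y : L => map_mul (spectralMulAlgNorm ℚ_[ℓ] L) x y
  simp only [spectralMulAlgNorm_def] at hmul
  have hone : spectralNorm ℚ_[ℓ] L 1 = 1 := spectralNorm_one
  have hunit : ∀ a : A, IsUnit a ↔ spectralNorm ℚ_[ℓ] L a = 1 := by
    intro a
    constructor
    · rintro ⟨u, rfl⟩
      have h1 := (hA _).1 (u : A).2
      have h2 := (hA _).1 (↑u⁻¹ : A).2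
      have h3 : spectralNorm ℚ_[ℓ] L ((u : A) : L) * spectralNorm ℚ_[ℓ] L ((↑u⁻¹ : A) : L) = 1 := by
        rw [← hmul, ← Subring.coe_mul, Units.mul_inv, Subring.coe_one, hone]
      nlinarith [spectralNorm_nonneg (K := ℚ_[ℓ]) ((u : A) : L),
        spectralNorm_nonneg (K := ℚ_[ℓ]) ((↑u⁻¹ : A) : L)]
    · intro h
      have h0 : (a : L) ≠ 0 := by
        intro h0
        rw [h0, spectralNorm_zero] at h
        exact zero_ne_one h
      have h3 : spectralNorm ℚ_[ℓ] L (a : L)⁻¹ = 1 := by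
        have := hmul (a : L) (a : L)⁻¹
        rw [mul_inv_cancel₀ h0, hone, h, one_mul] at this
        exact this.symm
      exact IsUnit.of_mul_eq_one ⟨(a : L)⁻¹, (hA _).2 h3.le⟩ (Subtype.ext (mul_inv_cancel₀ h0))
  have hlt : ∀ a : A, a ∈ nonunits A ↔ spectralNorm ℚ_[ℓ] L a < 1 := by
    intro a
    rw [mem_nonunits_iff, hunit]
    exact ⟨fun h => lt_of_le_of_ne ((hA _).1 a.2) h, fun h => h.ne⟩
  refine IsLocalRing.of_nonunits_add fun a b ha hb => ?_
  rw [hlt] at *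
  exact (isNonarchimedean_spectralNorm (K := ℚ_[ℓ]) (L := L) a b).trans_lt (max_lt ha hb)
end

variable [FiniteDimensional ℚ_[ℓ] K]

instance : IsLocalRing (IntegerRing ℓ K) :=
  isLocalRing_of_mem_iff (integralClosure (PadicInt.subring ℓ) K).toSubring fun _ => Iff.rfl

instance : IsLocalRing (IntegerRingBar ℓ K) := by
  have : Algebra.IsAlgebraic ℚ_[ℓ] (AlgebraicClosure K) :=
    Algebra.IsAlgebraic.trans ℚ_[ℓ] K (AlgebraicClosure K)
  refine isLocalRing_of_mem_iff (ℓ := ℓ)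
    (integralClosure (IntegerRing ℓ K) (AlgebraicClosure K)).toSubring fun x => ?_
  have : @IsScalarTower (PadicInt.subring ℓ) (IntegerRing ℓ K) (AlgebraicClosure K) _ _
      (padicIntAlgebra ℓ (AlgebraicClosure K)).toSMul :=
    @IsScalarTower.of_algebraMap_eq (PadicInt.subring ℓ) (IntegerRing ℓ K) (AlgebraicClosure K)
      _ _ _ _ _ (padicIntAlgebra ℓ (AlgebraicClosure K)) fun _ => rfl
  refine ⟨fun h => ?_, fun h => ?_⟩
  · exact isIntegral_trans (R := PadicInt.subring ℓ) (A := IntegerRing ℓ K) x h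
  · exact IsIntegral.tower_top (R := PadicInt.subring ℓ) h

instance : IsLocalHom (algebraMap (IntegerRing ℓ K) (IntegerRingBar ℓ K)) := inferInstance

/-- The residue field `k` of `𝒪_K`. -/
abbrev resField : Type u := ResidueField (IntegerRing ℓ K)
/-- The residue field of the integers of the algebraic closure of `K`. -/
abbrev resFieldBar : Type u := ResidueField (IntegerRingBar ℓ K)

instance : Finite (resField ℓ K) := by
  have : IsLocalRing (PadicInt.subring ℓ) := inferInstanceAs (IsLocalRing ℤ_[ℓ])
  have : Finite (ResidueField (PadicInt.subring ℓ)) :=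
    Finite.of_equiv _ (PadicInt.residueField (p := ℓ)).symm.toEquiv
  have : IsIntegrallyClosed (PadicInt.subring ℓ) :=
    inferInstanceAs (IsIntegrallyClosed ℤ_[ℓ])
  have : IsFractionRing (PadicInt.subring ℓ) ℚ_[ℓ] :=
    inferInstanceAs (IsFractionRing ℤ_[ℓ] ℚ_[ℓ])
  have : IsNoetherianRing (PadicInt.subring ℓ) :=
    inferInstanceAs (IsNoetherianRing ℤ_[ℓ])
  have : Module.Finite (PadicInt.subring ℓ) (IntegerRing ℓ K) :=
    IsIntegralClosure.finite (PadicInt.subring ℓ) ℚ_[ℓ] K (IntegerRing ℓ K)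
  have : FaithfulSMul (PadicInt.subring ℓ) (IntegerRing ℓ K) := by
    rw [faithfulSMul_iff_algebraMap_injective]
    intro x y h
    have h2 := congrArg (algebraMap (IntegerRing ℓ K) K) h
    rw [← IsScalarTower.algebraMap_apply, ← IsScalarTower.algebraMap_apply] at h2
    exact Subtype.ext ((algebraMap ℚ_[ℓ] K).injective h2)
  have : IsLocalHom (algebraMap (PadicInt.subring ℓ) (IntegerRing ℓ K)) :=
    Algebra.IsIntegral.isLocalHom _ _
  exact ResidueField.finite_of_finite (R := PadicInt.subring ℓ) inferInstance

instance : Fintype (resField ℓ K) := Fintype.ofFinite _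

instance : Algebra.IsAlgebraic (resField ℓ K) (resFieldBar ℓ K) := by
  refine ⟨fun x => ?_⟩
  obtain ⟨y, rfl⟩ := residue_surjective x
  refine IsIntegral.isAlgebraic ?_
  obtain ⟨P, hm, hP⟩ := Algebra.IsIntegral.isIntegral (R := IntegerRing ℓ K) y
  refine ⟨P.map (residue _), hm.map _, ?_⟩
  have := congrArg (residue (IntegerRingBar ℓ K)) hP
  rw [Polynomial.hom_eval₂, map_zero] at this
  rw [Polynomial.eval₂_map]
  exact this

theorem residueRing_not_finite : ¬ Finite (resFieldBar ℓ K) := by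
  intro hfin
  have := Fintype.ofFinite (resFieldBar ℓ K)
  set Q := Fintype.card (resFieldBar ℓ K) with hQ
  have hQ1 : 1 < Q := Fintype.one_lt_card
  let P : Polynomial (AlgebraicClosure K) := Polynomial.X ^ Q - Polynomial.X + 1
  let P' : Polynomial (IntegerRing ℓ K) := Polynomial.X ^ Q - Polynomial.X + 1
  have hm' : P'.Monic := by
    have : P' = Polynomial.X ^ Q + (- Polynomial.X + 1) := by simp only [P']; ring
    rw [this]
    refine Polynomial.monic_X_pow_add ?_
    refine lt_of_le_of_lt (b := (1 : WithBot ℕ)) ?_ (by exact_mod_cast hQ1)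
    compute_degree
  have hmap : P'.map (algebraMap (IntegerRing ℓ K) (AlgebraicClosure K)) = P := by simp [P, P']
  have hdeg : P.degree ≠ 0 := by
    have hd : P.degree = P'.degree := by rw [← hmap, hm'.degree_map]
    have hd' : P'.degree = Q := by
      have : P' = Polynomial.X ^ Q + (- Polynomial.X + 1) := by simp only [P']; ring
      rw [this, Polynomial.degree_add_eq_left_of_degree_lt, Polynomial.degree_X_pow]
      rw [Polynomial.degree_X_pow]
      refine lt_of_le_of_lt (b := (1 : WithBot ℕ)) ?_ (by exact_mod_cast hQ1)
      compute_degree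
    rw [hd, hd']
    have : Q ≠ 0 := by omega
    exact_mod_cast this
  obtain ⟨x, hx⟩ := IsAlgClosed.exists_root P hdeg
  have hint : IsIntegral (IntegerRing ℓ K) x :=
    ⟨P', hm', by rw [← Polynomial.eval_map, hmap]; exact hx⟩
  let y : IntegerRingBar ℓ K := ⟨x, hint⟩
  have hx' : y ^ Q - y + 1 = 0 := by
    apply Subtype.ext
    change x ^ Q - x + 1 = 0
    simpa [P, Polynomial.IsRoot] using hx
  have := congrArg (residue (IntegerRingBar ℓ K)) hx'
  rw [map_add, map_sub, map_pow, FiniteField.pow_card, sub_self, zero_add, map_one, map_zero]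
    at this
  exact one_ne_zero this

instance : SMulCommClass (Gal(AlgebraicClosure K/K)) (resField ℓ K)
    (resFieldBar ℓ K) where
  smul_comm g a x := by
    obtain ⟨a, rfl⟩ := residue_surjective a
    obtain ⟨x, rfl⟩ := residue_surjective x
    rw [Algebra.smul_def, Algebra.smul_def, smul_mul']
    congr 1
    rw [ResidueField.algebraMap_residue, ← ResidueField.residue_smul]
    rw [Algebra.algebraMap_eq_smul_one, smul_comm, smul_one]

/-- The action of `G_K` on the residue field of the algebraic closure, as a homomorphism to
`Gal(k̄/k)`. -/
def residueAction : Gal(AlgebraicClosure K/K) →* Gal(resFieldBar ℓ K/resField ℓ K) :=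
  MulSemiringAction.toAlgAut _ _ _

/-- The inertia subgroup `I_K`. -/
def inertia : Subgroup Gal(AlgebraicClosure K/K) := (residueAction ℓ K).ker

/-- The geometric Frobenius: the inverse of `x ↦ x ^ #k`. -/
def geomFrob : Gal(resFieldBar ℓ K/resField ℓ K) :=
  (FiniteField.frobeniusAlgEquivOfAlgebraic (resField ℓ K) (resFieldBar ℓ K))⁻¹

/-- The Weil group `W_K`: the elements of `G_K` acting on `k̄` as an integral power of the geometric
Frobenius. -/
def weilGroup : Subgroup Gal(AlgebraicClosure K/K) :=
  (Subgroup.zpowers (geomFrob ℓ K)).comap (residueAction ℓ K)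

variable {ℓ K} in
theorem exists_residueAction_eq (g : weilGroup ℓ K) :
    ∃ n : ℤ, geomFrob ℓ K ^ n = residueAction ℓ K g := g.2

theorem zpow_geomFrob_injective : Function.Injective fun n : ℤ => geomFrob ℓ K ^ n := by
  rw [injective_zpow_iff_not_isOfFinOrder, geomFrob, isOfFinOrder_inv_iff,
    isOfFinOrder_iff_pow_eq_one]
  rintro ⟨n, hn, h⟩
  apply residueRing_not_finite ℓ K
  set q := Fintype.card (resField ℓ K)
  have hq : 1 < q ^ n := Nat.one_lt_pow hn.ne' Fintype.one_lt_card
  let P : Polynomial (resFieldBar ℓ K) := Polynomial.X ^ (q ^ n) - Polynomial.X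
  have hP : P ≠ 0 := FiniteField.X_pow_card_sub_X_ne_zero _ hq
  refine Set.finite_univ_iff.1 ((P.rootSet_finite (resFieldBar ℓ K)).subset fun x _ => ?_)
  rw [Polynomial.mem_rootSet]
  refine ⟨hP, ?_⟩
  have h1 := DFunLike.congr_fun h x
  rw [AlgEquiv.coe_pow, FiniteField.coe_frobeniusAlgEquivOfAlgebraic_iterate] at h1
  simpa [P, sub_eq_zero] using h1

/-- The homomorphism `v_K : W_K → ℤ`, trivial on inertia, sending geometric Frobenius to `1`. -/
def weilVal : weilGroup ℓ K →* Multiplicative ℤ where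
  toFun g := Multiplicative.ofAdd (exists_residueAction_eq g).choose
  map_one' := by
    refine congrArg Multiplicative.ofAdd (zpow_geomFrob_injective ℓ K ?_)
    simp only [(exists_residueAction_eq (1 : weilGroup ℓ K)).choose_spec]
    simp
  map_mul' g h := by
    rw [← ofAdd_add]
    refine congrArg Multiplicative.ofAdd (zpow_geomFrob_injective ℓ K ?_)
    simp only [zpow_add, (exists_residueAction_eq _).choose_spec]
    simp

theorem inertia_le_weilGroup : inertia ℓ K ≤ weilGroup ℓ K := fun g hg => by
  have h : residueAction ℓ K g = 1 := hg
  change residueAction ℓ K g ∈ Subgroup.zpowers (geomFrob ℓ K)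
  rw [h]
  exact one_mem _

/-- The inclusion of `I_K` in `W_K`. -/
def inertiaEmb : inertia ℓ K →* weilGroup ℓ K := Subgroup.inclusion (inertia_le_weilGroup ℓ K)

/-- The topology of `W_K`, in which `I_K` with its Krull topology is open: `U` is open if and only if
`{i ∈ I_K | g i ∈ U}` is open in `I_K` for every `g ∈ W_K`. -/
@[reducible] def weilTopology : TopologicalSpace (weilGroup ℓ K) :=
  ⨆ g : weilGroup ℓ K, TopologicalSpace.coinduced
    (fun i : inertia ℓ K => g * inertiaEmb ℓ K i) inferInstance

variable {ℓ K}

/-- `v_K` with values in `ℤ`. -/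
def val (g : weilGroup ℓ K) : ℤ := Multiplicative.toAdd (weilVal ℓ K g)

theorem geomFrob_zpow_val (g : weilGroup ℓ K) :
    geomFrob ℓ K ^ val g = residueAction ℓ K g :=
  (exists_residueAction_eq g).choose_spec

theorem val_mul (g h : weilGroup ℓ K) : val (g * h) = val g + val h := by
  simp [val]

theorem val_one : val (1 : weilGroup ℓ K) = 0 := by
  simp [val]

theorem val_inv (g : weilGroup ℓ K) : val g⁻¹ = - val g := by
  simp [val]

theorem val_zpow (g : weilGroup ℓ K) (n : ℤ) : val (g ^ n) = n * val g := by
  simp [val]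

theorem val_eq_zero_iff (g : weilGroup ℓ K) :
    val g = 0 ↔ (g : Gal(AlgebraicClosure K/K)) ∈ inertia ℓ K := by
  rw [inertia, MonoidHom.mem_ker, ← geomFrob_zpow_val]
  refine ⟨fun h => by rw [h, zpow_zero], fun h => zpow_geomFrob_injective ℓ K ?_⟩
  simpa using h

theorem val_inertiaEmb (i : inertia ℓ K) : val (inertiaEmb ℓ K i) = 0 :=
  (val_eq_zero_iff _).2 i.2

theorem isOpen_weilTopology_iff (H : Subgroup (weilGroup ℓ K)) :
    IsOpen[weilTopology ℓ K] (H : Set (weilGroup ℓ K)) ↔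
      IsOpen ((H.comap (inertiaEmb ℓ K) : Subgroup (inertia ℓ K)) : Set (inertia ℓ K)) := by
  rw [weilTopology, isOpen_iSup_iff]
  simp only [isOpen_coinduced]
  constructor
  · intro h
    simpa using h 1
  · intro h g
    by_cases hg : ∃ i₀ : inertia ℓ K, g * inertiaEmb ℓ K i₀ ∈ H
    · obtain ⟨i₀, hi₀⟩ := hg
      have := h.preimage (continuous_const_mul i₀⁻¹)
      convert this using 1
      ext i
      have e : g * inertiaEmb ℓ K i =
          (g * inertiaEmb ℓ K i₀) * inertiaEmb ℓ K (i₀⁻¹ * i) := by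
        rw [map_mul, map_inv]; group
      simp only [Set.mem_preimage, SetLike.mem_coe, Subgroup.mem_comap]
      rw [e, H.mul_mem_cancel_left hi₀]
    · convert isOpen_empty
      ext i
      simpa using fun hi => hg ⟨i, hi⟩

theorem isClosed_inertia : IsClosed (inertia ℓ K : Set Gal(AlgebraicClosure K/K)) := by
  have e : (inertia ℓ K : Set Gal(AlgebraicClosure K/K)) =
      ⋂ y : IntegerRingBar ℓ K, (MulAction.stabilizer Gal(AlgebraicClosure K/K)
        (residue (IntegerRingBar ℓ K) y) : Set Gal(AlgebraicClosure K/K)) := by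
    ext g
    simp only [Set.mem_iInter, SetLike.mem_coe, MulAction.mem_stabilizer_iff, inertia,
      MonoidHom.mem_ker]
    constructor
    · intro h y
      exact DFunLike.congr_fun h (residue (IntegerRingBar ℓ K) y)
    · intro h
      refine AlgEquiv.ext fun x => ?_
      obtain ⟨y, rfl⟩ := residue_surjective x
      exact h y
  rw [e]
  refine isClosed_iInter fun y => Subgroup.isClosed_of_isOpen _ ?_
  refine Subgroup.isOpen_mono (H₁ := MulAction.stabilizer Gal(AlgebraicClosure K/K)
    (y.1 : AlgebraicClosure K)) (fun g hg => ?_) (stabilizer_isOpen_of_isIntegral _)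
  have h : g • y = y := Subtype.ext hg
  rw [MulAction.mem_stabilizer_iff, ← ResidueField.residue_smul, h]

instance : CompactSpace (inertia ℓ K) := by
  have : CharZero K := charZero_of_injective_algebraMap (algebraMap ℚ_[ℓ] K).injective
  exact isCompact_iff_compactSpace.1 isClosed_inertia.isCompact

theorem finite_range_inertia {M : Type*} [Monoid M] (r : weilGroup ℓ K →* M)
    (hr : IsOpen[weilTopology ℓ K] (r.ker : Set (weilGroup ℓ K))) :
    (Set.range fun i : inertia ℓ K => r (inertiaEmb ℓ K i)).Finite := by
  rw [isOpen_weilTopology_iff] at hr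
  have hfin := Subgroup.quotient_finite_of_isOpen _ hr
  set H := r.ker.comap (inertiaEmb ℓ K)
  let F : inertia ℓ K ⧸ H → M := Quotient.lift (fun i => r (inertiaEmb ℓ K i)) (by
    intro a b hab
    have h : a⁻¹ * b ∈ H := QuotientGroup.leftRel_apply.1 hab
    have h' : r (inertiaEmb ℓ K (a⁻¹ * b)) = 1 := h
    have e : inertiaEmb ℓ K b = inertiaEmb ℓ K a * inertiaEmb ℓ K (a⁻¹ * b) := by
      rw [← map_mul, mul_inv_cancel_left]
    change r (inertiaEmb ℓ K a) = r (inertiaEmb ℓ K b)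
    rw [e, map_mul r, h', mul_one])
  refine (Set.finite_range F).subset ?_
  rintro _ ⟨i, rfl⟩
  exact ⟨QuotientGroup.mk i, rfl⟩

theorem exists_pow_commute {M : Type*} [Monoid M] (r : weilGroup ℓ K →* M)
    (hr : IsOpen[weilTopology ℓ K] (r.ker : Set (weilGroup ℓ K)))
    (φ g : weilGroup ℓ K) (hg : val g = 0) :
    ∃ n : ℕ, 0 < n ∧ Commute (r g) (r φ ^ n) := by
  have hfin := finite_range_inertia r hr
  have hmem : ∀ k : ℕ, r (φ ^ k * g * (φ ^ k)⁻¹) ∈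
      Set.range fun i : inertia ℓ K => r (inertiaEmb ℓ K i) := fun k => by
    have h0 : val (φ ^ k * g * (φ ^ k)⁻¹) = 0 := by
      rw [val_mul, val_mul, val_inv, hg]; ring
    exact ⟨⟨_, (val_eq_zero_iff _).1 h0⟩, rfl⟩
  obtain ⟨k, l, hkl, h⟩ := hfin.exists_lt_map_eq_of_forall_mem hmem
  refine ⟨l - k, Nat.sub_pos_of_lt hkl, ?_⟩
  have hl : φ ^ l = φ ^ k * φ ^ (l - k) := by rw [← pow_add, Nat.add_sub_cancel' hkl.le]
  have h1 : r (φ ^ k)⁻¹ * r (φ ^ k * g * (φ ^ k)⁻¹) * r (φ ^ k * φ ^ (l - k)) =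
      r (φ ^ k)⁻¹ * r (φ ^ l * g * (φ ^ l)⁻¹) * r (φ ^ k * φ ^ (l - k)) := by rw [h]
  rw [← map_mul, ← map_mul, ← map_mul, ← map_mul, hl] at h1
  have e1 : (φ ^ k)⁻¹ * (φ ^ k * g * (φ ^ k)⁻¹) * (φ ^ k * φ ^ (l - k)) = g * φ ^ (l - k) := by
    group
  have e2 : (φ ^ k)⁻¹ * (φ ^ k * φ ^ (l - k) * g * (φ ^ k * φ ^ (l - k))⁻¹) *
      (φ ^ k * φ ^ (l - k)) = φ ^ (l - k) * g := by
    group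
  rw [e1, e2, map_mul, map_mul, map_pow] at h1
  exact h1

end Arithmetic


/-! ### Weil--Deligne representations -/

section WeilDeligne

variable (ℓ : ℕ) [Fact ℓ.Prime] (K : Type u) [Field K] [Algebra ℚ_[ℓ] K] [FiniteDimensional ℚ_[ℓ] K]
variable (p : ℕ) [Fact p.Prime]

/-- `q`, the cardinality of the residue field of `𝒪_K`. -/
def resCard : ℕ := Nat.card (resField ℓ K)

theorem resCard_ne_zero : (resCard ℓ K : PadicAlgCl p) ≠ 0 := by
  exact_mod_cast Nat.card_pos.ne'

/-- A Weil--Deligne representation `(r, N)` of `W_K` on the `ℚ̄_p`-vector space `V`. -/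
structure WeilDeligneRep (V : Type*) [AddCommGroup V] [Module (PadicAlgCl p) V] where
  r : Representation (PadicAlgCl p) (weilGroup ℓ K) V
  isOpen_ker : IsOpen[weilTopology ℓ K] (r.ker : Set (weilGroup ℓ K))
  N : Module.End (PadicAlgCl p) V
  isNilpotent_N : IsNilpotent N
  conj_N : ∀ σ, r σ * N * r σ⁻¹ = (resCard ℓ K : PadicAlgCl p) ^ (-val σ) • N

/-- The unramified character `ψ : g ↦ s ^ v_K(g)`, sending geometric Frobenius to `s` (to be applied
to a square root `s` of `q`). -/
def psi (s : (PadicAlgCl p)ˣ) : weilGroup ℓ K →* (PadicAlgCl p)ˣ where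
  toFun g := s ^ val g
  map_one' := by rw [val_one, zpow_zero]
  map_mul' g h := by rw [val_mul, zpow_add]

theorem psi_zpow_eq_one (s : (PadicAlgCl p)ˣ) (n : ℤ) (g : weilGroup ℓ K) (hg : val g = 0) :
    (psi ℓ K p s ^ n) g = 1 := by
  simp [psi, hg]

/-- The lifts to `W_K` of the geometric Frobenius. -/
def FrobLift : Type u := {φ : weilGroup ℓ K // val φ = 1}

variable {ℓ K p}

/-- `α` is a `q`-Weil number of weight `w`: it is algebraic over `ℚ`, and all its complex conjugates
(the images of `α` under the embeddings `ℚ(α) → ℂ`) have absolute value `q ^ (w / 2)`. -/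
def IsWeilNumber (q : ℕ) (w : ℤ) (α : PadicAlgCl p) : Prop :=
  IsAlgebraic ℚ α ∧ ∀ z : ℂ, Polynomial.aeval z (minpoly ℚ α) = 0 → ‖z‖ = (q : ℝ) ^ ((w : ℝ) / 2)

namespace WeilDeligneRep

variable {V V' : Type*} [AddCommGroup V] [Module (PadicAlgCl p) V]
  [AddCommGroup V'] [Module (PadicAlgCl p) V']

/-- The monodromy filtration `M_k = ∑_{i - j = k} ker N ^ (i + 1) ∩ im N ^ j`, `i, j ≥ 0`. -/
def monodromyFiltration (D : WeilDeligneRep ℓ K p V) (k : ℤ) : Submodule (PadicAlgCl p) V :=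
  ⨆ (i : ℕ) (j : ℕ) (_ : (i : ℤ) - j = k), LinearMap.ker (D.N ^ (i + 1)) ⊓ LinearMap.range (D.N ^ j)

theorem r_mul_N (D : WeilDeligneRep ℓ K p V) (σ : weilGroup ℓ K) :
    D.r σ * D.N = (resCard ℓ K : PadicAlgCl p) ^ (-val σ) • (D.N * D.r σ) := by
  have h := congrArg (· * D.r σ) (D.conj_N σ)
  simp only [mul_assoc, ← map_mul, inv_mul_cancel, map_one, mul_one, smul_mul_assoc] at h
  exact h

theorem r_mul_N_pow (D : WeilDeligneRep ℓ K p V) (σ : weilGroup ℓ K) (k : ℕ) :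
    D.r σ * D.N ^ k = ((resCard ℓ K : PadicAlgCl p) ^ (-val σ)) ^ k • (D.N ^ k * D.r σ) := by
  induction k with
  | zero => simp
  | succ k ih =>
    rw [pow_succ, ← mul_assoc, ih, smul_mul_assoc, mul_assoc, r_mul_N, mul_smul_comm, smul_smul,
      ← pow_succ, mul_assoc]

theorem monodromyFiltration_le_comap (D : WeilDeligneRep ℓ K p V) (σ : weilGroup ℓ K) (k : ℤ) :
    D.monodromyFiltration k ≤ (D.monodromyFiltration k).comap (D.r σ) := by
  rw [monodromyFiltration]
  refine iSup_le fun i => iSup_le fun j => iSup_le fun h => ?_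
  refine le_trans ?_ (Submodule.comap_mono
    (le_iSup_of_le i (le_iSup_of_le j (le_iSup_of_le h le_rfl))))
  rintro x ⟨hx, y, rfl⟩
  have hc : (resCard ℓ K : PadicAlgCl p) ^ (-val σ) ≠ 0 := zpow_ne_zero _ (resCard_ne_zero ℓ K p)
  refine ⟨?_, ?_⟩
  · have h1 := LinearMap.congr_fun (D.r_mul_N_pow σ (i + 1)) ((D.N ^ j) y)
    rw [Module.End.mul_apply, show (D.N ^ (i + 1)) ((D.N ^ j) y) = 0 from hx, map_zero] at h1
    exact ((smul_eq_zero.1 h1.symm).resolve_left (pow_ne_zero _ hc))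
  · have h1 := LinearMap.congr_fun (D.r_mul_N_pow σ j) y
    exact ⟨(((resCard ℓ K : PadicAlgCl p) ^ (-val σ)) ^ j) • D.r σ y, by
      rw [map_smul]; exact h1.symm⟩

/-- The `k`-th graded piece `M_k / M_{k-1}` of the monodromy filtration. -/
abbrev gr (D : WeilDeligneRep ℓ K p V) (k : ℤ) : Type _ :=
  D.monodromyFiltration k ⧸
    (D.monodromyFiltration (k - 1)).submoduleOf (D.monodromyFiltration k)

/-- The action of `W_K` on the graded pieces of the monodromy filtration. -/
def grMap (D : WeilDeligneRep ℓ K p V) (k : ℤ) (σ : weilGroup ℓ K) :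
    Module.End (PadicAlgCl p) (D.gr k) :=
  Submodule.mapQ _ _ ((D.r σ).restrict (D.monodromyFiltration_le_comap σ k))
    fun _ hx => D.monodromyFiltration_le_comap σ (k - 1) hx

/-- `(r, N)` is pure of weight `w`: for every `i` the eigenvalues of `φ` on the `i`-th graded piece of
the monodromy filtration are `q`-Weil numbers of weight `w + i`. -/
def IsPure (D : WeilDeligneRep ℓ K p V) (φ : FrobLift ℓ K) (w : ℤ) : Prop :=
  ∀ (i : ℤ) (α : PadicAlgCl p), (D.grMap i φ.1).HasEigenvalue α →
    IsWeilNumber (resCard ℓ K) (w + i) α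

/-- The twist `χ ⊗ (r, N) = (χ r, N)` by an unramified character. -/
def twist (χ : weilGroup ℓ K →* (PadicAlgCl p)ˣ) (hχ : ∀ g, val g = 0 → χ g = 1)
    (D : WeilDeligneRep ℓ K p V) : WeilDeligneRep ℓ K p V where
  r :=
    { toFun := fun g => (χ g : PadicAlgCl p) • D.r g
      map_one' := by simp
      map_mul' := fun g h => by
        rw [map_mul, map_mul, Units.val_mul, smul_mul_smul_comm] }
  isOpen_ker := by
    have h := D.isOpen_ker
    rw [isOpen_weilTopology_iff] at h ⊢
    convert h using 2
    ext i
    simp [MonoidHom.mem_ker, hχ _ (val_inertiaEmb i)]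
  N := D.N
  isNilpotent_N := D.isNilpotent_N
  conj_N σ := by
    simp only [MonoidHom.coe_mk, OneHom.coe_mk]
    rw [smul_mul_assoc, smul_mul_assoc, mul_smul_comm, D.conj_N, map_inv, ← mul_smul,
      Units.mul_inv, one_smul]

/-- `ψ ^ n ⊗ (r, N)`. -/
def psiTwist (s : (PadicAlgCl p)ˣ) (n : ℤ) (D : WeilDeligneRep ℓ K p V) :
    WeilDeligneRep ℓ K p V :=
  D.twist (psi ℓ K p s ^ n) (psi_zpow_eq_one ℓ K p s n)

/-- The normalized trace of `(r, N)`, pure of weight `w`: the trace of `ψ ^ (-w) ⊗ r`. -/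
def normalizedTrace (D : WeilDeligneRep ℓ K p V) (s : (PadicAlgCl p)ˣ) (w : ℤ)
    (g : weilGroup ℓ K) : PadicAlgCl p :=
  LinearMap.trace (PadicAlgCl p) V ((D.psiTwist s (-w)).r g)

/-- Isomorphism of Weil--Deligne representations: a linear isomorphism that commutes with the actions
of `W_K` and with the monodromy operators. -/
def IsIsomorphic (D : WeilDeligneRep ℓ K p V) (D' : WeilDeligneRep ℓ K p V') : Prop :=
  ∃ e : V ≃ₗ[PadicAlgCl p] V',
    (∀ g x, e (D.r g x) = D'.r g (e x)) ∧ ∀ x, e (D.N x) = D'.N (e x)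

variable [FiniteDimensional (PadicAlgCl p) V]

/-- The unipotent part `u` in the decomposition `f = s u = u s` (it is determined by `f`, by uniqueness
of the Jordan decomposition). -/
def unipotentPart (f : (Module.End (PadicAlgCl p) V)ˣ) : (Module.End (PadicAlgCl p) V)ˣ :=
  (exists_unipotent_semisimple f).choose

/-- `r(φ)ᵘ`, the unipotent part of `r(φ)`. -/
def frobUnipotent (D : WeilDeligneRep ℓ K p V) (φ : FrobLift ℓ K) :
    (Module.End (PadicAlgCl p) V)ˣ :=
  unipotentPart (D.r.toHomUnits φ.1)

theorem frobUnipotent_spec (D : WeilDeligneRep ℓ K p V) (φ : FrobLift ℓ K) :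
    ∃ s : (Module.End (PadicAlgCl p) V)ˣ, D.r φ.1 = s * D.frobUnipotent φ ∧
      Commute (s : Module.End (PadicAlgCl p) V) (D.frobUnipotent φ) ∧
      (s : Module.End (PadicAlgCl p) V).IsSemisimple ∧
      IsNilpotent ((D.frobUnipotent φ : Module.End (PadicAlgCl p) V) - 1) := by
  obtain ⟨s, h1, h2, h3, h4⟩ := (exists_unipotent_semisimple (D.r.toHomUnits φ.1)).choose_spec
  exact ⟨s, congrArg Units.val h1, congrArg Units.val h2, h3, h4⟩

theorem commute_r_frobUnipotent (D : WeilDeligneRep ℓ K p V) (φ : FrobLift ℓ K)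
    (g : weilGroup ℓ K) :
    Commute (D.r g) (D.frobUnipotent φ : Module.End (PadicAlgCl p) V) := by
  obtain ⟨s, h1, h2, h3, h4⟩ := D.frobUnipotent_spec φ
  have hφ : Commute (D.r φ.1) (D.frobUnipotent φ : Module.End (PadicAlgCl p) V) := by
    rw [h1]; exact h2.mul_left (Commute.refl _)
  have hi : ∀ i, val i = 0 →
      Commute (D.r i) (D.frobUnipotent φ : Module.End (PadicAlgCl p) V) := by
    intro i hi
    obtain ⟨n, hn, hc⟩ := exists_pow_commute D.r D.isOpen_ker φ.1 i hi
    rw [h1] at hc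
    exact commute_unipotent_of_commute_pow h2 h3 h4 hn hc s.isUnit
  have hz : ∀ n : ℤ, Commute (D.r (φ.1 ^ n))
      (D.frobUnipotent φ : Module.End (PadicAlgCl p) V) := by
    intro n
    have h5 : Commute (D.r.toHomUnits φ.1) (D.frobUnipotent φ) := Units.ext hφ
    have h6 := congrArg Units.val (h5.zpow_left n)
    rwa [← map_zpow] at h6
  have e : g = (g * φ.1 ^ (-val g)) * φ.1 ^ val g := by group
  rw [e, map_mul]
  refine (hi _ ?_).mul_left (hz _)
  rw [val_mul, val_zpow, φ.2]; ring

theorem commute_frobUnipotent_N (D : WeilDeligneRep ℓ K p V) (φ : FrobLift ℓ K) :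
    Commute (D.frobUnipotent φ : Module.End (PadicAlgCl p) V) D.N := by
  obtain ⟨s, h1, h2, h3, h4⟩ := D.frobUnipotent_spec φ
  have h := D.r_mul_N φ.1
  rw [h1] at h
  exact commute_unipotent_of_smul h2 h3 h4 s.isUnit h

/-- The Frobenius-semisimplification `(r̃, N)` with `r̃(g) = r(g) (r(φ)ᵘ) ^ (-v_K(g))`. -/
def frobSS (D : WeilDeligneRep ℓ K p V) (φ : FrobLift ℓ K) : WeilDeligneRep ℓ K p V where
  r :=
    { toFun := fun g => D.r g * ↑(D.frobUnipotent φ ^ (-val g))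
      map_one' := by rw [val_one]; simp
      map_mul' := fun g h => by
        have hc : Commute (D.r h) (↑(D.frobUnipotent φ ^ (-val g)) : Module.End _ V) := by
          have h5 : Commute (D.r.toHomUnits h) (D.frobUnipotent φ) :=
            Units.ext (D.commute_r_frobUnipotent φ h)
          exact congrArg Units.val (h5.zpow_right (-val g))
        rw [val_mul, neg_add, zpow_add, Units.val_mul, map_mul, mul_assoc, ← mul_assoc (D.r h),
          hc.eq]
        simp only [mul_assoc] }
  isOpen_ker := by
    have h := D.isOpen_ker
    rw [isOpen_weilTopology_iff] at h ⊢
    convert h using 2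
    ext i
    simp [MonoidHom.mem_ker, val_inertiaEmb i]
  N := D.N
  isNilpotent_N := D.isNilpotent_N
  conj_N σ := by
    have hN : ∀ n : ℤ, Commute (↑(D.frobUnipotent φ ^ n) : Module.End _ V) D.N := by
      intro n
      have h := D.commute_frobUnipotent_N φ
      cases n with
      | ofNat n => simpa using h.pow_left n
      | negSucc n =>
        rw [zpow_negSucc]
        exact Commute.units_inv_left (by simpa using h.pow_left (n + 1))
    simp only [MonoidHom.coe_mk, OneHom.coe_mk]
    have hc : Commute (D.r σ⁻¹) (↑(D.frobUnipotent φ ^ (- val σ⁻¹)) : Module.End _ V) := by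
      have h5 : Commute (D.r.toHomUnits σ⁻¹) (D.frobUnipotent φ) :=
        Units.ext (D.commute_r_frobUnipotent φ σ⁻¹)
      exact congrArg Units.val (h5.zpow_right _)
    rw [hc.eq, ← D.conj_N, mul_assoc (D.r σ), (hN _).eq, ← mul_assoc, ← mul_assoc,
      mul_assoc (D.r σ * D.N), ← Units.val_mul, ← zpow_add, val_inv]
    simp

end WeilDeligneRep

end WeilDeligne

end LocalField

end

/-!
Let `D₁`, `D₂` be the Frobenius-semisimplifications, twisted by `ψ ^ (-w₁)` and `ψ ^ (-w₂)`, so that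
both are pure of weight `0` and have the same trace (`trace_frobSS_psiTwist`: multiplying by a commuting
unipotent operator does not change traces). It is enough to show `D₁ ≅ D₂`.

*Weights.* Fix `n > 0` such that `z = φ ^ n` acts centrally on both spaces. The absolute value obtained
from an isomorphism `ℚ̄_p ≃ ℂ` measures the weight of a Weil number, so by purity a `z`-eigenvector in
`M_k` but not in `M_{k-1}` has an eigenvalue of absolute value `q ^ (n k / 2)` (`IsPure.isPureOperator`).
As `z` is semisimple, `V` is the direct sum of its parts `V_i` of weight `i`, and `N` maps `V_i` to
`V_{i-2}`. The inclusions `ker N ^ i ⊆ M_{i-1}` and `M_{-i} ⊆ im N ^ i` show that `N ^ i : V_i → V_{-i}` is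
bijective for `i ≥ 0` (`IsPureOperator.lefschetzGrading`).

*Traces.* The projection onto `V_i` is a polynomial in the action of `z`, and one polynomial serves both
representations. Hence `g` has the same trace on the `i`-th pieces of both. Since
`V_i = P_i ⊕ N V_{i+2}` with `P_i = V_i ∩ ker N ^ (i + 1)`, it also has the same trace on the primitive parts
`P_i` (`LefschetzGrading.trace_restrict_prim`).

*Isomorphisms.* The `P_i` are semisimple representations, because the image of `W_K` is finite modulo
the powers of the semisimple operator `z` (`isSemisimpleRepresentation_of_isFiniteModPowers`), so
their traces determine them (`exists_equiv_of_trace_eq`, a consequence of the density theorem).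
The resulting isomorphisms of primitive parts extend to `V = ⨁_{0 ≤ j ≤ i} N ^ j P_i`, compatibly with `N`
and `W_K` (`LefschetzGrading.exists_equiv_of_trace_mul_eq`).
-/

noncomputable section

namespace LocalField

/-! ### Characters of semisimple modules -/

section ModuleCharacter

variable (F : Type*) {A : Type*} [Field F] [Ring A] [Algebra F A]

/-- The character `a ↦ tr (a | M)` of a module `M` over an `F`-algebra. -/
def moduleCharacter (M : Type*) [AddCommGroup M] [Module F M] [Module A M] [IsScalarTower F A M]
    (a : A) : F :=
  LinearMap.trace F M (Algebra.lsmul F F M a)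

variable {M M' : Type*} [AddCommGroup M] [Module F M] [Module A M] [IsScalarTower F A M]
  [AddCommGroup M'] [Module F M'] [Module A M'] [IsScalarTower F A M']

theorem moduleCharacter_congr (e : M ≃ₗ[A] M') (a : A) :
    moduleCharacter F M a = moduleCharacter F M' a := by
  rw [moduleCharacter, moduleCharacter, ← LinearMap.trace_conj' _ (e.restrictScalars F)]
  congr 1
  ext x
  simp [LinearEquiv.conj_apply]

theorem isSemisimpleModule_prod [IsSemisimpleModule A M] [IsSemisimpleModule A M'] :
    IsSemisimpleModule A (M × M') := by
  have h := IsSemisimpleModule.sup (IsSemisimpleModule.range (LinearMap.inl A M M'))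
    (IsSemisimpleModule.range (LinearMap.inr A M M'))
  rw [LinearMap.sup_range_inl_inr] at h
  exact IsSemisimpleModule.congr Submodule.topEquiv.symm

variable [FiniteDimensional F M] [FiniteDimensional F M']

theorem moduleCharacter_prod (a : A) :
    moduleCharacter F (M × M') a = moduleCharacter F M a + moduleCharacter F M' a := by
  rw [moduleCharacter, moduleCharacter, moduleCharacter, ← LinearMap.trace_prodMap']
  rfl

theorem finiteDimensional_submodule (X : Submodule A M) : FiniteDimensional F X :=
  FiniteDimensional.of_injective (X.subtype.restrictScalars F) X.subtype_injective

theorem finrank_submodule_lt {X : Submodule A M} (h : X ≠ ⊤) :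
    Module.finrank F X < Module.finrank F M := by
  refine Submodule.finrank_lt (s := X.restrictScalars F) fun h' => h ?_
  exact (Submodule.restrictScalars_eq_top_iff F A M).1 h'

/-- If there are no nonzero homomorphisms in either direction, then the projection of `M × M'` to
`M` commutes with all endomorphisms, so that by the density theorem some `a : A` acts as `1` on `M`
and as `0` on `M'`: the characters differ at `a`. -/
theorem exists_linearMap_ne_zero_or [CharZero F] [IsSemisimpleModule A M] [IsSemisimpleModule A M']
    [Nontrivial M] (h : ∀ a : A, moduleCharacter F M a = moduleCharacter F M' a) :
    (∃ f : M →ₗ[A] M', f ≠ 0) ∨ ∃ f : M' →ₗ[A] M, f ≠ 0 := by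
  by_contra! H
  obtain ⟨h1, h2⟩ := H
  let π : Module.End (Module.End A (M × M')) (M × M') :=
    { toFun := fun x => (x.1, 0)
      map_add' := fun x y => by simp
      map_smul' := fun g x => by
        have e1 : (g (x.1, 0)).2 = 0 :=
          LinearMap.congr_fun (h1 (LinearMap.snd A M M' ∘ₗ g ∘ₗ LinearMap.inl A M M')) x.1
        have e2 : (g (0, x.2)).1 = 0 :=
          LinearMap.congr_fun (h2 (LinearMap.fst A M M' ∘ₗ g ∘ₗ LinearMap.inr A M M')) x.2
        have e3 : g x = g (x.1, 0) + g (0, x.2) := by rw [← map_add]; simp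
        simp only [Module.End.smul_def, RingHom.id_apply]
        ext
        · simp [e3, e2]
        · simp [e1] }
  have := isSemisimpleModule_prod (A := A) (M := M) (M' := M')
  let b := Module.finBasis F (M × M')
  obtain ⟨a, ha⟩ := jacobson_density (R := A) π (Set.finite_range b).toFinset
  have ha' : ∀ x : M × M', ((x.1, 0) : M × M') = a • x := by
    have : LinearMap.inl F M M' ∘ₗ LinearMap.fst F M M' = Algebra.lsmul F F (M × M') a :=
      b.ext fun i => ha (b i) (by simp)
    exact fun x => LinearMap.congr_fun this x
  have e1 : moduleCharacter F M a = Module.finrank F M := by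
    rw [← LinearMap.trace_one, moduleCharacter]
    congr 1
    ext x
    exact (congrArg Prod.fst (ha' (x, 0))).symm
  have e2 : moduleCharacter F M' a = 0 := by
    rw [← map_zero (LinearMap.trace F M'), moduleCharacter]
    congr 1
    ext x
    exact (congrArg Prod.snd (ha' (0, x))).symm
  have := h a
  rw [e1, e2, Nat.cast_eq_zero] at this
  exact (Module.finrank_pos (R := F) (M := M)).ne' this

/-- For semisimple modules a nonzero map `M' → M` yields a nonzero map `M → M'`. -/
theorem exists_linearMap_ne_zero [CharZero F] [IsSemisimpleModule A M] [IsSemisimpleModule A M']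
    [Nontrivial M] (h : ∀ a : A, moduleCharacter F M a = moduleCharacter F M' a) :
    ∃ f : M →ₗ[A] M', f ≠ 0 := by
  refine (exists_linearMap_ne_zero_or F h).elim id fun ⟨g, hg⟩ => ?_
  obtain ⟨C, hC⟩ := exists_isCompl (LinearMap.ker g)
  obtain ⟨R, hR⟩ := exists_isCompl (LinearMap.range g)
  let e : C ≃ₗ[A] LinearMap.range g :=
    (Submodule.quotientEquivOfIsCompl _ _ hC).symm.trans g.quotKerEquivRange
  refine ⟨C.subtype ∘ₗ e.symm.toLinearMap ∘ₗ Submodule.projectionOnto _ _ hR, fun h0 => hg ?_⟩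
  ext x
  have := LinearMap.congr_fun h0 (g x)
  simp only [LinearMap.comp_apply, LinearMap.zero_apply, Submodule.coe_subtype,
    LinearEquiv.coe_coe, ZeroMemClass.coe_eq_zero, LinearEquiv.map_eq_zero_iff] at this
  have h3 := Submodule.projectionOnto_apply_left hR ⟨g x, x, rfl⟩
  rw [this] at h3
  exact (congrArg Subtype.val h3).symm

variable (M M') in
/-- In characteristic zero, semisimple modules of finite dimension with the same character are
isomorphic. -/
theorem nonempty_linearEquiv_of_moduleCharacter_eq [CharZero F] [IsSemisimpleModule A M]
    [IsSemisimpleModule A M'] (h : ∀ a : A, moduleCharacter F M a = moduleCharacter F M' a) :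
    Nonempty (M ≃ₗ[A] M') := by
  induction hn : Module.finrank F M using Nat.strong_induction_on generalizing M M' with
  | _ n ih =>
  rcases subsingleton_or_nontrivial M with hM | hM
  · have h1 := h 1
    simp only [moduleCharacter, map_one, LinearMap.trace_one, Nat.cast_inj] at h1
    rw [Module.finrank_zero_of_subsingleton] at h1
    have := Module.finrank_zero_iff.1 h1.symm
    exact ⟨0⟩
  · obtain ⟨f, hf⟩ := exists_linearMap_ne_zero F h
    obtain ⟨C, hC⟩ := exists_isCompl (LinearMap.ker f)
    obtain ⟨R, hR⟩ := exists_isCompl (LinearMap.range f)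
    let e : C ≃ₗ[A] LinearMap.range f :=
      (Submodule.quotientEquivOfIsCompl _ _ hC).symm.trans f.quotKerEquivRange
    have := finiteDimensional_submodule F (LinearMap.ker f)
    have := finiteDimensional_submodule F C
    have := finiteDimensional_submodule F R
    have := finiteDimensional_submodule F (LinearMap.range f)
    let e1 := Submodule.prodEquivOfIsCompl _ _ hC
    let e2 := Submodule.prodEquivOfIsCompl _ _ hR
    have hk : ∀ a : A, moduleCharacter F (LinearMap.ker f) a = moduleCharacter F R a := fun a => by
      have := h a
      rw [← moduleCharacter_congr F e1, ← moduleCharacter_congr F e2, moduleCharacter_prod,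
        moduleCharacter_prod, moduleCharacter_congr F e, add_comm] at this
      exact add_left_cancel this
    have hlt : Module.finrank F (LinearMap.ker f) < n := by
      rw [← hn]
      exact finrank_submodule_lt F fun h' => hf (LinearMap.ker_eq_top.1 h')
    obtain ⟨e3⟩ := ih _ hlt (LinearMap.ker f) R hk rfl
    exact ⟨e1.symm.trans (((e3.prodCongr e).trans (LinearEquiv.prodComm A _ _)).trans e2)⟩

end ModuleCharacter

/-! ### Complete reducibility and characters of representations -/

section Rep

open Representation

variable {F W V V' : Type*} [Field F] [Group W] [AddCommGroup V] [Module F V]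
  [AddCommGroup V'] [Module F V']

variable [CharZero F]

/-- In characteristic zero, semisimple representations of finite dimension with the same trace are
isomorphic. -/
theorem exists_equiv_of_trace_eq [FiniteDimensional F V] [FiniteDimensional F V']
    (ρ : Representation F W V) (ρ' : Representation F W V')
    (hρ : ρ.IsSemisimpleRepresentation) (hρ' : ρ'.IsSemisimpleRepresentation)
    (h : ∀ g, LinearMap.trace F V (ρ g) = LinearMap.trace F V' (ρ' g)) :
    ∃ e : V ≃ₗ[F] V', ∀ g x, e (ρ g x) = ρ' g (e x) := by
  rw [isSemisimpleRepresentation_iff_isSemisimpleModule_asModule] at hρ hρ'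
  let m : Module (MonoidAlgebra F W) V := Module.compHom V ρ.asAlgebraHom.toRingHom
  let m' : Module (MonoidAlgebra F W) V' := Module.compHom V' ρ'.asAlgebraHom.toRingHom
  have ht : IsScalarTower F (MonoidAlgebra F W) V :=
    ⟨fun a b x => LinearMap.congr_fun (map_smul ρ.asAlgebraHom a b) x⟩
  have ht' : IsScalarTower F (MonoidAlgebra F W) V' :=
    ⟨fun a b x => LinearMap.congr_fun (map_smul ρ'.asAlgebraHom a b) x⟩
  have hs : IsSemisimpleModule (MonoidAlgebra F W) V := hρ
  have hs' : IsSemisimpleModule (MonoidAlgebra F W) V' := hρ'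
  have hsmul : ∀ g (x : V), MonoidAlgebra.of F W g • x = ρ g x := fun g x =>
    LinearMap.congr_fun (ρ.asAlgebraHom_of g) x
  have hsmul' : ∀ g (x : V'), MonoidAlgebra.of F W g • x = ρ' g x := fun g x =>
    LinearMap.congr_fun (ρ'.asAlgebraHom_of g) x
  have key : ∀ a : MonoidAlgebra F W, LinearMap.trace F V (ρ.asAlgebraHom a) =
      LinearMap.trace F V' (ρ'.asAlgebraHom a) := by
    intro a
    induction a using MonoidAlgebra.induction_on with
    | of g => simpa using h g
    | add a b ha hb => simp [ha, hb]
    | smul r a ha => simp [ha]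
  obtain ⟨e⟩ := nonempty_linearEquiv_of_moduleCharacter_eq (A := MonoidAlgebra F W) F
    V V' key
  exact ⟨e.restrictScalars F, fun g x => by
    rw [← hsmul, ← hsmul', LinearEquiv.restrictScalars_apply, map_smul]; rfl⟩

/-- The image of `ρ` is finite modulo the powers of `ρ z`. -/
def IsFiniteModPowers (ρ : Representation F W V) (z : W) : Prop :=
  ∃ T : Set W, T.Finite ∧ ∀ g, ∃ t ∈ T, ∃ k : ℤ, ρ g = ρ (t * z ^ k)

/-- A representation `ρ` is completely reducible if some `z` acts semisimply and the image of `ρ`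
is finite modulo the powers of `ρ z`: the conjugates of a `z`-equivariant projection
onto a subrepresentation are finite in number, and their average is equivariant. -/
theorem isSemisimpleRepresentation_of_isFiniteModPowers (ρ : Representation F W V) (z : W)
    (hz : Module.End.IsSemisimple (ρ z)) (h : IsFiniteModPowers ρ z) :
    ρ.IsSemisimpleRepresentation := by
  obtain ⟨T, hT, hW⟩ := h
  refine ⟨fun X => ?_⟩
  obtain ⟨Y, hY, hXY⟩ := Module.End.isSemisimple_iff.1 hz X.toSubmodule
    (fun x hx => X.apply_mem_toSubmodule z hx)
  set π : Module.End F V := X.toSubmodule.subtype ∘ₗ Submodule.projectionOnto _ _ hXY with hπ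
  have hπX : ∀ x ∈ X.toSubmodule, π x = x := fun x hx =>
    congrArg Subtype.val (Submodule.projectionOnto_apply_left hXY ⟨x, hx⟩)
  have hπm : ∀ x, π x ∈ X.toSubmodule := fun x => by simp [hπ]
  have hπY : ∀ x ∈ Y, π x = 0 := fun x hx =>
    congrArg Subtype.val (Submodule.projectionOnto_apply_right hXY ⟨x, hx⟩)
  have hπz : π * ρ z = ρ z * π := by
    ext x
    obtain ⟨a, ha, b, hb, rfl⟩ := Submodule.mem_sup.1
      (show x ∈ X.toSubmodule ⊔ Y by rw [hXY.sup_eq_top]; trivial)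
    simp only [Module.End.mul_apply, map_add]
    rw [hπX a ha, hπY b hb, hπX _ (X.apply_mem_toSubmodule z ha), hπY _ (hY hb), map_zero]
  -- the conjugate of `π` by `g` depends only on `g` modulo the powers of `z`
  let cj : W → Module.End F V := fun g => ρ g * π * ρ g⁻¹
  have hinv : ∀ g : W, ρ g * ρ g⁻¹ = 1 := fun g => by rw [← map_mul]; simp
  have hinv' : ∀ g : W, ρ g⁻¹ * ρ g = 1 := fun g => by rw [← map_mul]; simp
  have hcz : ∀ k : ℤ, π * ρ (z ^ k) = ρ (z ^ k) * π := by
    intro k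
    have h5 : SemiconjBy π (ρ.asGroupHom z : Module.End F V) (ρ.asGroupHom z) := by
      rw [ρ.asGroupHom_apply]; exact hπz
    have h6 := h5.units_zpow_right k
    rw [← map_zpow, ρ.asGroupHom_apply] at h6
    exact h6
  have hfin : (Set.range cj).Finite := by
    refine (hT.image cj).subset ?_
    rintro _ ⟨g, rfl⟩
    obtain ⟨t, ht, k, hk⟩ := hW g
    refine ⟨t, ht, ?_⟩
    have hk' : ρ g⁻¹ = ρ (t * z ^ k)⁻¹ := by
      calc ρ g⁻¹ = ρ g⁻¹ * (ρ (t * z ^ k) * ρ (t * z ^ k)⁻¹) := by rw [hinv, mul_one]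
        _ = _ := by rw [← hk, ← mul_assoc, hinv', one_mul]
    simp only [cj]
    rw [hk, hk', mul_inv_rev, map_mul, map_mul]
    simp only [mul_assoc (ρ t)]
    rw [← hcz, ← mul_assoc (π * _), mul_assoc π (ρ (z ^ k)), hinv, mul_one]
  set O : Finset (Module.End F V) := hfin.toFinset with hO
  have hcjO : ∀ g, cj g ∈ O := fun g => by simp [hO]
  have hO0 : (O.card : F) ≠ 0 := by
    rw [Nat.cast_ne_zero]; exact Finset.card_ne_zero_of_mem (hcjO 1)
  let Q : Module.End F V := (O.card : F)⁻¹ • ∑ f ∈ O, f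
  have hQX : ∀ x ∈ X.toSubmodule, Q x = x := by
    intro x hx
    have : ∀ f ∈ O, f x = x := by
      intro f hf
      obtain ⟨g, rfl⟩ : ∃ g, cj g = f := by simpa [hO] using hf
      simp only [cj, Module.End.mul_apply]
      rw [hπX _ (X.apply_mem_toSubmodule _ hx), ← Module.End.mul_apply, hinv]; rfl
    simp only [Q, LinearMap.smul_apply, LinearMap.sum_apply]
    rw [Finset.sum_congr rfl this, Finset.sum_const, ← Nat.cast_smul_eq_nsmul F, smul_smul,
      inv_mul_cancel₀ hO0, one_smul]
  have hQm : ∀ x, Q x ∈ X.toSubmodule := by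
    intro x
    simp only [Q, LinearMap.smul_apply, LinearMap.sum_apply]
    refine Submodule.smul_mem _ _ (Submodule.sum_mem _ fun f hf => ?_)
    obtain ⟨g, rfl⟩ : ∃ g, cj g = f := by simpa [hO] using hf
    exact X.apply_mem_toSubmodule _ (hπm _)
  have hQc : ∀ g, ρ g * Q = Q * ρ g := by
    intro g
    have h1 : ∑ f ∈ O, ρ g * f = ∑ f ∈ O, f * ρ g := by
      refine Finset.sum_bij' (fun f _ => ρ g * f * ρ g⁻¹) (fun f _ => ρ g⁻¹ * f * ρ g) ?_ ?_ ?_ ?_ ?_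
      · intro f hf
        obtain ⟨h, rfl⟩ : ∃ g, cj g = f := by simpa [hO] using hf
        convert hcjO (g * h) using 1
        simp [cj, mul_assoc]
      · intro f hf
        obtain ⟨h, rfl⟩ : ∃ g, cj g = f := by simpa [hO] using hf
        convert hcjO (g⁻¹ * h) using 1
        simp [cj, mul_assoc]
      · intro f _
        rw [mul_assoc, mul_assoc, mul_assoc, hinv', mul_one, ← mul_assoc, hinv', one_mul]
      · intro f _
        rw [mul_assoc, mul_assoc, mul_assoc, hinv, mul_one, ← mul_assoc, hinv, one_mul]
      · intro f _
        rw [mul_assoc (ρ g * f), hinv', mul_one]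
    simp only [Q, mul_smul_comm, smul_mul_assoc, Finset.mul_sum, Finset.sum_mul, h1]
  refine ⟨⟨LinearMap.ker Q, fun g x hx => ?_⟩, ?_⟩
  · have := LinearMap.congr_fun (hQc g) x
    simp only [Module.End.mul_apply, LinearMap.mem_ker.1 hx, map_zero] at this
    exact this.symm
  · have hcompl := LinearMap.isCompl_of_proj (f := Q.codRestrict X.toSubmodule hQm)
      (fun x => Subtype.ext (hQX x x.2))
    rw [LinearMap.ker_codRestrict] at hcompl
    constructor
    · rw [disjoint_iff]
      exact Subrepresentation.toSubmodule_injective hcompl.inf_eq_bot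
    · rw [codisjoint_iff]
      exact Subrepresentation.toSubmodule_injective hcompl.sup_eq_top

end Rep

/-! ### Lefschetz gradings and primitive parts -/

section Lefschetz

variable {F V V' : Type*} [Field F] [AddCommGroup V] [Module F V] [AddCommGroup V'] [Module F V']

theorem pow_mul_of_forall_mul {N : Module.End F V} {E : ℤ → Module.End F V}
    (hE : ∀ i, N * E i = E (i - 2) * N) (j : ℕ) (i : ℤ) :
    N ^ j * E i = E (i - 2 * j) * N ^ j := by
  induction j with
  | zero => simp
  | succ j ih =>
    rw [pow_succ', mul_assoc, ih, ← mul_assoc, hE, mul_assoc]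
    congr 2
    push_cast; ring

theorem mul_pow_of_mul_eq_smul {N f : Module.End F V} {c : F} (hN : f * N = c • (N * f)) (j : ℕ) :
    f * N ^ j = c ^ j • (N ^ j * f) := by
  induction j with
  | zero => simp
  | succ j ih =>
    rw [pow_succ, ← mul_assoc, ih, smul_mul_assoc, mul_assoc, hN, mul_smul_comm, smul_smul,
      ← pow_succ, mul_assoc]

/-- A grading `V = ⨁ V_i` for which `N` has degree `-2` and `N ^ i : V_i → V_{-i}` is bijective for
`i ≥ 0`. It is encoded by the projections `E i` onto the `V_i`, which vanish for `|i| > bound`. -/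
structure LefschetzGrading (N : Module.End F V) where
  E : ℤ → Module.End F V
  bound : ℕ
  mul_self : ∀ i, E i * E i = E i
  mul_of_ne : ∀ i j, i ≠ j → E i * E j = 0
  eq_zero : ∀ i : ℤ, (bound : ℤ) < |i| → E i = 0
  sum_eq_one : ∑ i ∈ Finset.Icc (-(bound : ℤ)) bound, E i = 1
  N_mul : ∀ i, N * E i = E (i - 2) * N
  inj : ∀ (i : ℕ) (x : V), E i x = x → (N ^ i) x = 0 → x = 0
  surj : ∀ (i : ℕ) (y : V), E (-i) y = y → ∃ x, E i x = x ∧ (N ^ i) x = y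

namespace LefschetzGrading

variable {N : Module.End F V} {N' : Module.End F V'} (L : LefschetzGrading N)
  (L' : LefschetzGrading N')

/-- The graded piece `V_i`. -/
def piece (i : ℤ) : Submodule F V := LinearMap.eqLocus (L.E i) 1

/-- The primitive part `V_i ∩ ker N ^ (i + 1)`, for `i ≥ 0`. -/
def prim (i : ℕ) : Submodule F V := L.piece i ⊓ LinearMap.ker (N ^ (i + 1))

theorem mem_piece {i : ℤ} {x : V} : x ∈ L.piece i ↔ L.E i x = x := Iff.rfl

theorem apply_mem_piece (i : ℤ) (x : V) : L.E i x ∈ L.piece i :=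
  LinearMap.congr_fun (L.mul_self i) x

theorem apply_eq_zero_of_mem_piece {i j : ℤ} (h : i ≠ j) {x : V} (hx : x ∈ L.piece j) :
    L.E i x = 0 := by
  rw [← L.mem_piece.1 hx]
  exact LinearMap.congr_fun (L.mul_of_ne i j h) x

theorem pow_mul (j : ℕ) (i : ℤ) : N ^ j * L.E i = L.E (i - 2 * j) * N ^ j :=
  pow_mul_of_forall_mul L.N_mul j i

theorem pow_apply (j : ℕ) (i : ℤ) (x : V) : (N ^ j) (L.E i x) = L.E (i - 2 * j) ((N ^ j) x) :=
  LinearMap.congr_fun (L.pow_mul j i) x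

theorem pow_mem_piece (j : ℕ) {i : ℤ} {x : V} (hx : x ∈ L.piece i) :
    (N ^ j) x ∈ L.piece (i - 2 * j) := by
  rw [mem_piece, ← L.pow_apply, L.mem_piece.1 hx]

theorem pow_eq_zero_of_mem_prim {i j : ℕ} (h : i < j) {x : V} (hx : x ∈ L.prim i) :
    (N ^ j) x = 0 := by
  obtain ⟨k, rfl⟩ := Nat.exists_eq_add_of_le (Nat.succ_le_of_lt h)
  rw [Nat.succ_eq_add_one, add_comm, pow_add, Module.End.mul_apply, LinearMap.mem_ker.1 hx.2,
    map_zero]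

theorem prim_eq_bot {i : ℕ} (h : L.bound < i) : L.prim i = ⊥ := by
  rw [eq_bot_iff]
  intro x hx
  have h1 : L.E i = 0 := L.eq_zero _ (by rw [Nat.abs_cast]; exact_mod_cast h)
  have := L.mem_piece.1 hx.1
  rw [h1] at this
  exact this.symm

theorem N_mem_piece {i : ℤ} {z : V} (hz : z ∈ L.piece (i + 2)) : N z ∈ L.piece i := by
  have h := L.pow_mem_piece 1 hz
  rwa [pow_one, show i + 2 - 2 * ((1 : ℕ) : ℤ) = i by push_cast; ring] at h

theorem exists_prim_add (i : ℕ) {x : V} (hx : x ∈ L.piece i) :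
    ∃ y ∈ L.prim i, ∃ z ∈ L.piece (i + 2), x = y + N z := by
  have h1 := L.pow_mem_piece (i + 1) hx
  rw [show (i : ℤ) - 2 * ((i + 1 : ℕ) : ℤ) = -((i + 2 : ℕ) : ℤ) by push_cast; ring] at h1
  obtain ⟨z, hz, hzx⟩ := L.surj (i + 2) _ h1
  have hz' : z ∈ L.piece (i + 2) := by simpa [mem_piece] using hz
  refine ⟨x - N z, ⟨Submodule.sub_mem _ hx (L.N_mem_piece hz'), ?_⟩, z, hz', by abel⟩
  change (N ^ (i + 1)) (x - N z) = 0
  rw [map_sub, ← hzx, ← Module.End.mul_apply, ← pow_succ, sub_self]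

/-- `V` is spanned by the images under powers of `N` of the primitive elements. -/
theorem mem_of_forall_prim (S : Submodule F V)
    (hS : ∀ (i j : ℕ), ∀ y ∈ L.prim i, (N ^ j) y ∈ S) (x : V) : x ∈ S := by
  have hpos : ∀ (m i : ℕ), L.bound < i + m → ∀ x ∈ L.piece i, ∀ j, (N ^ j) x ∈ S := by
    intro m
    induction m with
    | zero =>
      intro i hi x hx j
      have h1 : L.E i = 0 := L.eq_zero _ (by rw [Nat.abs_cast]; exact_mod_cast hi)
      rw [mem_piece, h1] at hx
      rw [← hx]
      simp
    | succ m ih =>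
      intro i hi x hx j
      obtain ⟨y, hy, z, hz, rfl⟩ := L.exists_prim_add i hx
      rw [map_add, ← Module.End.mul_apply, ← pow_succ]
      refine S.add_mem (hS i j y hy) ?_
      by_cases hm : L.bound < i + 2
      · exact ih (i + 2) (by omega) z (by exact_mod_cast hz) _
      · exact ih (i + 2) (by omega) z (by exact_mod_cast hz) _
  have hpiece : ∀ i : ℤ, ∀ x ∈ L.piece i, x ∈ S := by
    intro i x hx
    obtain ⟨n, rfl | rfl⟩ := i.eq_nat_or_neg
    · exact hpos (L.bound + 1) n (by omega) x hx 0
    · obtain ⟨y, hy, rfl⟩ := L.surj n x hx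
      exact hpos (L.bound + 1) n (by omega) y hy n
  rw [← Module.End.one_apply (R := F) x, ← L.sum_eq_one, LinearMap.sum_apply]
  exact S.sum_mem fun i _ => hpiece i _ (L.apply_mem_piece i x)

/-- Pairs `(i, j)` with `j ≤ i < n`: the summands `N ^ j P_i` of the Lefschetz decomposition. -/
abbrev StringIndex (n : ℕ) : Type := {t : Fin n × Fin n // t.2 ≤ t.1}

/-- The Lefschetz decomposition: the map `(y_{ij}) ↦ ∑ N ^ j y_{ij}` on families of primitive
elements. -/
def stringSum (n : ℕ) : ((t : StringIndex n) → L.prim t.1.1) →ₗ[F] V :=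
  ∑ t : StringIndex n, (N ^ (t.1.2 : ℕ)) ∘ₗ (L.prim t.1.1).subtype ∘ₗ LinearMap.proj t

theorem stringSum_apply (n : ℕ) (y : (t : StringIndex n) → L.prim t.1.1) :
    L.stringSum n y = ∑ t : StringIndex n, (N ^ (t.1.2 : ℕ)) (y t : V) := by
  simp [stringSum]

theorem stringSum_single (n : ℕ) (t : StringIndex n) (y : L.prim t.1.1) :
    L.stringSum n (Pi.single t y) = (N ^ (t.1.2 : ℕ)) (y : V) := by
  rw [stringSum_apply, Finset.sum_eq_single t]
  · simp
  · intro b _ hb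
    rw [Pi.single_eq_of_ne hb]; simp
  · simp

/-- Uniqueness of the Lefschetz decomposition. -/
theorem stringSum_injective (n : ℕ) : Function.Injective (L.stringSum n) := by
  classical
  rw [← LinearMap.ker_eq_bot, LinearMap.ker_eq_bot']
  intro y hy
  by_contra hne
  obtain ⟨t₁, ht₁⟩ := Function.ne_iff.1 hne
  -- the summands with `j` maximal are detected by a projection and a power of `N`
  obtain ⟨t₀, ht₀, hmax⟩ := Finset.exists_max_image
    (Finset.univ.filter fun t : StringIndex n => y t ≠ 0) (fun t => t.1.2) ⟨t₁, by simpa using ht₁⟩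
  simp only [Finset.mem_filter, Finset.mem_univ, true_and] at ht₀ hmax
  rw [stringSum_apply] at hy
  have h1 := congrArg (fun v => (N ^ ((t₀.1.1 : ℕ) - t₀.1.2)) (L.E (t₀.1.1 - 2 * t₀.1.2) v)) hy
  simp only [map_sum, map_zero] at h1
  have hle : (t₀.1.2 : ℕ) ≤ t₀.1.1 := t₀.2
  rw [Finset.sum_eq_single t₀] at h1
  · rw [← L.pow_apply, L.mem_piece.1 (y t₀).2.1, ← Module.End.mul_apply, ← pow_add,
      Nat.sub_add_cancel hle] at h1
    exact ht₀ (Subtype.ext (L.inj _ _ (y t₀).2.1 h1))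
  · intro t _ ht
    by_cases hyt : y t = 0
    · simp [hyt]
    have hj : (t.1.2 : ℕ) ≤ t₀.1.2 := hmax t hyt
    have hmem := L.pow_mem_piece t.1.2 (y t).2.1
    by_cases hw : ((t₀.1.1 : ℕ) : ℤ) - 2 * ((t₀.1.2 : ℕ) : ℤ) =
        ((t.1.1 : ℕ) : ℤ) - 2 * ((t.1.2 : ℕ) : ℤ)
    · have hlt : (t.1.2 : ℕ) < t₀.1.2 := by
        refine lt_of_le_of_ne hj fun h => ht ?_
        exact Subtype.ext (Prod.ext (Fin.ext (by omega)) (Fin.ext h))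
      rw [hw, L.mem_piece.1 hmem, ← Module.End.mul_apply, ← pow_add]
      exact L.pow_eq_zero_of_mem_prim (by omega) (y t).2
    · rw [L.apply_eq_zero_of_mem_piece hw hmem, map_zero]
  · simp

theorem stringSum_surjective {n : ℕ} (hn : L.bound < n) : Function.Surjective (L.stringSum n) := by
  classical
  rw [← LinearMap.range_eq_top, eq_top_iff]
  intro x _
  refine L.mem_of_forall_prim _ (fun i j y hy => ?_) x
  by_cases hi : L.bound < i
  · rw [L.prim_eq_bot hi] at hy
    rw [(Submodule.mem_bot F).1 hy, map_zero]
    exact Submodule.zero_mem _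
  by_cases hj : i < j
  · rw [L.pow_eq_zero_of_mem_prim hj hy]
    exact Submodule.zero_mem _
  exact ⟨Pi.single ⟨(⟨i, by omega⟩, ⟨j, by omega⟩), not_lt.1 hj⟩ ⟨y, hy⟩, L.stringSum_single n _ _⟩

/-- Isomorphisms between the primitive parts extend to an isomorphism that commutes with the
operators `N`. -/
theorem exists_equiv_of_prim_equiv (f : ∀ i, L.prim i ≃ₗ[F] L'.prim i) :
    ∃ e : V ≃ₗ[F] V', ∀ (i j : ℕ) (y : L.prim i), e ((N ^ j) y) = (N' ^ j) (f i y) := by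
  classical
  let n := L.bound + L'.bound + 1
  let a := LinearEquiv.ofBijective (L.stringSum n)
    ⟨L.stringSum_injective n, L.stringSum_surjective (by omega)⟩
  let a' := LinearEquiv.ofBijective (L'.stringSum n)
    ⟨L'.stringSum_injective n, L'.stringSum_surjective (by omega)⟩
  refine ⟨a.symm.trans ((LinearEquiv.piCongrRight fun t : StringIndex n => f t.1.1).trans a'),
    fun i j y => ?_⟩
  by_cases hi : L.bound < i
  · have hy : (y : V) = 0 := (Submodule.mem_bot F).1 (L.prim_eq_bot hi ▸ y.2)
    have hy' : y = 0 := Subtype.ext hy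
    simp [hy']
  by_cases hj : i < j
  · rw [L.pow_eq_zero_of_mem_prim hj y.2, L'.pow_eq_zero_of_mem_prim hj (f i y).2, map_zero]
  let t : StringIndex n := ⟨(⟨i, by omega⟩, ⟨j, by omega⟩), not_lt.1 hj⟩
  have h1 : a.symm ((N ^ j) y) = Pi.single t y := by
    rw [LinearEquiv.symm_apply_eq]
    exact (L.stringSum_single n t y).symm
  have h2 : (LinearEquiv.piCongrRight fun t : StringIndex n => f t.1.1) (Pi.single t y) =
      Pi.single t (f i y) := by
    ext b
    by_cases hb : b = t
    · subst hb
      simp [t]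
    · simp [Pi.single_eq_of_ne hb]
  rw [LinearEquiv.trans_apply, LinearEquiv.trans_apply, h1, h2]
  exact L'.stringSum_single n t (f i y)

/-! ### Traces on primitive parts -/

theorem apply_mem_piece_of_commute {f : Module.End F V} (hf : ∀ i, Commute f (L.E i)) {i : ℤ}
    {x : V} (hx : x ∈ L.piece i) : f x ∈ L.piece i := by
  have h := LinearMap.congr_fun (hf i).eq x
  rw [Module.End.mul_apply, Module.End.mul_apply, L.mem_piece.1 hx] at h
  exact h.symm

theorem trace_restrict_piece [FiniteDimensional F V] {f : Module.End F V}
    (hf : ∀ i, Commute f (L.E i)) (i : ℤ) :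
    LinearMap.trace F (L.piece i) (f.restrict fun _ => L.apply_mem_piece_of_commute hf) =
      LinearMap.trace F V (f * L.E i) := by
  set p := (L.E i).codRestrict (L.piece i) (L.apply_mem_piece i)
  set g := f.restrict fun _ => L.apply_mem_piece_of_commute hf (i := i)
  have h1 : f * L.E i = (L.piece i).subtype ∘ₗ (g ∘ₗ p) := rfl
  have h2 : g = (g ∘ₗ p) ∘ₗ (L.piece i).subtype := by
    ext x
    have : p x = x := Subtype.ext (L.mem_piece.1 x.2)
    simp [this]
  rw [h1, LinearMap.trace_comp_comm', ← h2]

theorem apply_mem_prim {f : Module.End F V} (hf : ∀ i, Commute f (L.E i)) {c : F} (hc : c ≠ 0)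
    (hN : f * N = c • (N * f)) {i : ℕ} {x : V} (hx : x ∈ L.prim i) : f x ∈ L.prim i := by
  refine ⟨L.apply_mem_piece_of_commute hf hx.1, ?_⟩
  have h := LinearMap.congr_fun (mul_pow_of_mul_eq_smul hN (i + 1)) x
  rw [Module.End.mul_apply, LinearMap.mem_ker.1 hx.2, map_zero] at h
  exact (smul_eq_zero.1 h.symm).resolve_left (pow_ne_zero _ hc)

/-- The decomposition `V_i = P_i ⊕ N V_{i+2}` for `i ≥ 0`. -/
def primProdEquiv (i : ℕ) : (L.prim i × L.piece (i + 2)) ≃ₗ[F] L.piece i :=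
  LinearEquiv.ofBijective
    (LinearMap.coprod (Submodule.inclusion inf_le_left)
      (N.restrict fun _ => L.N_mem_piece)) <| by
    constructor
    · rw [← LinearMap.ker_eq_bot, LinearMap.ker_eq_bot']
      rintro ⟨y, z⟩ h
      have h1 : (y : V) + N z = 0 := congrArg Subtype.val h
      have h2 := congrArg (N ^ (i + 1)) h1
      rw [map_add, LinearMap.mem_ker.1 y.2.2, zero_add, map_zero, ← Module.End.mul_apply,
        ← pow_succ] at h2
      have hz : (z : V) = 0 := L.inj (i + 2) z (by exact_mod_cast z.2) h2
      rw [hz, map_zero, add_zero] at h1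
      exact Prod.ext (Subtype.ext h1) (Subtype.ext hz)
    · rintro ⟨x, hx⟩
      obtain ⟨y, hy, z, hz, rfl⟩ := L.exists_prim_add i hx
      exact ⟨(⟨y, hy⟩, ⟨z, hz⟩), rfl⟩

/-- The trace on `P_i ≅ V_i / N V_{i+2}`; the factor `c` comes from moving `f` past `N`. -/
theorem trace_restrict_prim [FiniteDimensional F V] {f : Module.End F V}
    (hf : ∀ i, Commute f (L.E i)) {c : F} (hc : c ≠ 0) (hN : f * N = c • (N * f)) (i : ℕ) :
    LinearMap.trace F (L.prim i) (f.restrict fun _ => L.apply_mem_prim hf hc hN) =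
      LinearMap.trace F V (f * L.E i) - c * LinearMap.trace F V (f * L.E (i + 2)) := by
  rw [eq_sub_iff_add_eq, ← L.trace_restrict_piece hf, ← L.trace_restrict_piece hf, ← smul_eq_mul,
    ← map_smul, ← LinearMap.trace_prodMap', ← LinearMap.trace_conj' _ (L.primProdEquiv i)]
  congr 1
  refine LinearMap.ext fun x => ?_
  obtain ⟨⟨y, z⟩, rfl⟩ := (L.primProdEquiv i).surjective x
  rw [LinearEquiv.conj_apply_apply, LinearEquiv.symm_apply_apply]
  apply Subtype.ext
  change f y + N (c • f z) = f (y + N z)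
  rw [map_add, map_smul]
  exact congrArg _ (LinearMap.congr_fun hN (z : V)).symm

variable {W : Type*} [Group W]

/-- The primitive part as a subrepresentation. -/
def primRep {ρ : Representation F W V} {χ : W → F} (hχ : ∀ g, χ g ≠ 0)
    (hE : ∀ g i, Commute (ρ g) (L.E i)) (hN : ∀ g, ρ g * N = χ g • (N * ρ g)) (i : ℕ) :
    Subrepresentation ρ :=
  ⟨L.prim i, fun g _ => L.apply_mem_prim (hE g) (hχ g) (hN g)⟩

theorem isSemisimpleRepresentation_primRep [CharZero F] {ρ : Representation F W V} {χ : W → F}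
    (hχ : ∀ g, χ g ≠ 0) (hE : ∀ g i, Commute (ρ g) (L.E i))
    (hN : ∀ g, ρ g * N = χ g • (N * ρ g)) (i : ℕ) {z : W} (hz : Module.End.IsSemisimple (ρ z))
    (hT : IsFiniteModPowers ρ z) :
    (L.primRep hχ hE hN i).toRepresentation.IsSemisimpleRepresentation := by
  obtain ⟨T, hT, hW⟩ := hT
  refine isSemisimpleRepresentation_of_isFiniteModPowers _ z ?_ ⟨T, hT, fun g => ?_⟩
  · exact Module.End.IsSemisimple.restrict (fun x hx => L.apply_mem_prim (hE z) (hχ z) (hN z) hx) hz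
  · obtain ⟨t, ht, k, hk⟩ := hW g
    refine ⟨t, ht, k, LinearMap.ext fun x => Subtype.ext ?_⟩
    exact LinearMap.congr_fun hk (x : V)

/-- Two semisimple representations with operators `N` that define Lefschetz gradings are
isomorphic, compatibly with `N`, as soon as the graded pieces have the same traces: the trace on
`V_i` minus the twisted trace on `V_{i+2}` is the trace on the primitive part. -/
theorem exists_equiv_of_trace_mul_eq [CharZero F] [FiniteDimensional F V] [FiniteDimensional F V']
    {ρ : Representation F W V} {ρ' : Representation F W V'} {χ : W → F} (hχ : ∀ g, χ g ≠ 0)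
    (hE : ∀ g i, Commute (ρ g) (L.E i)) (hE' : ∀ g i, Commute (ρ' g) (L'.E i))
    (hN : ∀ g, ρ g * N = χ g • (N * ρ g)) (hN' : ∀ g, ρ' g * N' = χ g • (N' * ρ' g))
    {z : W} (hz : Module.End.IsSemisimple (ρ z)) (hz' : Module.End.IsSemisimple (ρ' z))
    (hT : IsFiniteModPowers ρ z) (hT' : IsFiniteModPowers ρ' z)
    (htr : ∀ g i, LinearMap.trace F V (ρ g * L.E i) = LinearMap.trace F V' (ρ' g * L'.E i)) :
    ∃ e : V ≃ₗ[F] V', (∀ g x, e (ρ g x) = ρ' g (e x)) ∧ ∀ x, e (N x) = N' (e x) := by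
  have hf : ∀ i, ∃ f : L.prim i ≃ₗ[F] L'.prim i, ∀ g (y : L.prim i),
      f ⟨ρ g y, L.apply_mem_prim (hE g) (hχ g) (hN g) y.2⟩ =
        ⟨ρ' g (f y), L'.apply_mem_prim (hE' g) (hχ g) (hN' g) (f y).2⟩ := by
    intro i
    refine exists_equiv_of_trace_eq (L.primRep hχ hE hN i).toRepresentation
      (L'.primRep hχ hE' hN' i).toRepresentation
      (L.isSemisimpleRepresentation_primRep hχ hE hN i hz hT)
      (L'.isSemisimpleRepresentation_primRep hχ hE' hN' i hz' hT') fun g => ?_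
    refine (L.trace_restrict_prim (hE g) (hχ g) (hN g) i).trans ?_
    rw [htr, htr]
    exact (L'.trace_restrict_prim (hE' g) (hχ g) (hN' g) i).symm
  choose f hf using hf
  obtain ⟨e, he⟩ := L.exists_equiv_of_prim_equiv L' f
  refine ⟨e, fun g x => ?_, fun x => ?_⟩
  · refine L.mem_of_forall_prim (LinearMap.eqLocus (e.toLinearMap ∘ₗ ρ g) (ρ' g ∘ₗ e.toLinearMap))
      (fun i j y hy => ?_) x
    have h1 := LinearMap.congr_fun (mul_pow_of_mul_eq_smul (hN g) j) y
    have h2 := LinearMap.congr_fun (mul_pow_of_mul_eq_smul (hN' g) j) (f i ⟨y, hy⟩ : V')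
    have h3 := he i j ⟨ρ g y, L.apply_mem_prim (hE g) (hχ g) (hN g) hy⟩
    rw [hf i g ⟨y, hy⟩] at h3
    change e (ρ g ((N ^ j) y)) = ρ' g (e ((N ^ j) y))
    rw [he i j ⟨y, hy⟩, ← Module.End.mul_apply, h1, ← Module.End.mul_apply, h2]
    rw [LinearMap.smul_apply, map_smul, Module.End.mul_apply, h3]
    rfl
  · refine L.mem_of_forall_prim (LinearMap.eqLocus (e.toLinearMap ∘ₗ N) (N' ∘ₗ e.toLinearMap))
      (fun i j y hy => ?_) x
    change e (N ((N ^ j) y)) = N' (e ((N ^ j) y))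
    rw [he i j ⟨y, hy⟩, ← Module.End.mul_apply, ← pow_succ', he i (j + 1) ⟨y, hy⟩, pow_succ',
      Module.End.mul_apply]

end LefschetzGrading

end Lefschetz

/-! ### The weight grading of a pure operator -/

section Weights

open Polynomial

variable {F V V' : Type*} [Field F] [AddCommGroup V] [Module F V] [AddCommGroup V'] [Module F V']

/-- The monodromy filtration `M_k = ∑_{i - j = k} ker N ^ (i + 1) ∩ im N ^ j` of an operator `N`. -/
def monodromyFil (N : Module.End F V) (k : ℤ) : Submodule F V :=
  ⨆ (i : ℕ) (j : ℕ) (_ : (i : ℤ) - j = k), LinearMap.ker (N ^ (i + 1)) ⊓ LinearMap.range (N ^ j)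

theorem le_monodromyFil (N : Module.End F V) {i j : ℕ} {k : ℤ} (h : (i : ℤ) - j = k) :
    LinearMap.ker (N ^ (i + 1)) ⊓ LinearMap.range (N ^ j) ≤ monodromyFil N k :=
  le_iSup_of_le i (le_iSup_of_le j (le_iSup_of_le h le_rfl))

theorem monodromyFil_mono (N : Module.End F V) : Monotone (monodromyFil N) := by
  refine monotone_int_of_le_succ fun k => ?_
  refine iSup_le fun i => iSup_le fun j => iSup_le fun h => ?_
  refine le_trans (inf_le_inf_right _ ?_)
    (le_monodromyFil N (i := i + 1) (j := j) (by push_cast; omega))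
  intro x hx
  rw [LinearMap.mem_ker] at hx ⊢
  rw [pow_succ', Module.End.mul_apply, hx, map_zero]

theorem ker_pow_le_monodromyFil (N : Module.End F V) (i : ℕ) :
    LinearMap.ker (N ^ (i + 1)) ≤ monodromyFil N i := by
  refine le_trans (le_inf le_rfl ?_) (le_monodromyFil N (i := i) (j := 0) (k := i) (by simp))
  rw [pow_zero, Module.End.one_eq_id, LinearMap.range_id]
  exact le_top

theorem monodromyFil_le_range (N : Module.End F V) (i : ℕ) :
    monodromyFil N (-i) ≤ LinearMap.range (N ^ i) := by
  refine iSup_le fun a => iSup_le fun b => iSup_le fun h => inf_le_right.trans ?_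
  obtain ⟨c, rfl⟩ : ∃ c, b = i + c := ⟨b - i, by omega⟩
  rintro _ ⟨y, rfl⟩
  exact ⟨(N ^ c) y, by rw [pow_add]; rfl⟩

theorem monodromyFil_eq_top {N : Module.End F V} {n : ℕ} (hn : N ^ n = 0) :
    monodromyFil N n = ⊤ := by
  rw [eq_top_iff]
  refine le_trans (fun x _ => ?_) (ker_pow_le_monodromyFil N n)
  rw [LinearMap.mem_ker, pow_succ, hn, zero_mul]; rfl

theorem monodromyFil_eq_bot {N : Module.End F V} {n : ℕ} (hn : N ^ n = 0) :
    monodromyFil N (-n) = ⊥ := by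
  rw [eq_bot_iff]
  refine (monodromyFil_le_range N n).trans ?_
  rw [hn, LinearMap.range_zero]

theorem apply_mem_monodromyFil {N f : Module.End F V} (h : Commute f N) {k : ℤ} {x : V}
    (hx : x ∈ monodromyFil N k) : f x ∈ monodromyFil N k := by
  suffices monodromyFil N k ≤ (monodromyFil N k).comap f from this hx
  refine iSup_le fun i => iSup_le fun j => iSup_le fun hk => le_trans ?_
    (Submodule.comap_mono (le_monodromyFil N hk))
  rintro x ⟨hx, y, rfl⟩
  have e1 := LinearMap.congr_fun (h.pow_right (i + 1)).eq ((N ^ j) y)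
  rw [Module.End.mul_apply, Module.End.mul_apply, LinearMap.mem_ker.1 hx, map_zero] at e1
  exact ⟨e1.symm, f y, (LinearMap.congr_fun (h.pow_right j).eq y).symm⟩

/-- The place of a nonzero vector in the monodromy filtration. -/
theorem exists_mem_notMem_monodromyFil {N : Module.End F V} {n : ℕ} (hn : N ^ n = 0) {x : V}
    (hx : x ≠ 0) : ∃ k : ℤ, |k| ≤ n ∧ x ∈ monodromyFil N k ∧ x ∉ monodromyFil N (k - 1) := by
  have hbot : ∀ k, x ∈ monodromyFil N k → -(n : ℤ) < k := fun k hk => by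
    by_contra! hlt
    have := monodromyFil_mono N hlt hk
    rw [monodromyFil_eq_bot hn] at this
    exact hx ((Submodule.mem_bot F).1 this)
  have htop : x ∈ monodromyFil N n := by rw [monodromyFil_eq_top hn]; trivial
  obtain ⟨k, hk, hmin⟩ := Int.exists_least_of_bdd (P := fun k => x ∈ monodromyFil N k)
    ⟨-n, fun k hk => (hbot k hk).le⟩ ⟨n, htop⟩
  refine ⟨k, abs_le.2 ⟨(hbot k hk).le, hmin n htop⟩, hk, fun h => ?_⟩
  have := hmin _ h
  omega

/-- `A` is semisimple, `A N = a N A` for some `a` with `‖a‖ = b⁻²`, and the eigenvalues of `A` on the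
`k`-th graded piece of the monodromy filtration of `N` have norm `b ^ k`. The norm is any
multiplicative function `F → ℝ`. -/
structure IsPureOperator (nrm : F →*₀ ℝ) (b : ℝ) (N A : Module.End F V) : Prop where
  isSemisimple : A.IsSemisimple
  isNilpotent : IsNilpotent N
  one_lt : 1 < b
  mul_eq_smul : ∃ a : F, A * N = a • (N * A) ∧ nrm a = b ^ (-2 : ℤ)
  weight : ∀ (k : ℤ) (α : F) (x : V), A x = α • x → x ∈ monodromyFil N k →
    x ∉ monodromyFil N (k - 1) → nrm α = b ^ k

open Classical in
/-- The polynomial that takes the value `1` at the `α ∈ T` with `‖α‖ = b ^ i`, and `0` at the other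
elements of `T`. -/
def weightPoly (nrm : F →*₀ ℝ) (b : ℝ) (T : Finset F) (i : ℤ) : F[X] :=
  ∑ α ∈ T with nrm α = b ^ i, Lagrange.basis T id α

open Classical in
theorem eval_weightPoly (nrm : F →*₀ ℝ) (b : ℝ) {T : Finset F} (i : ℤ) {β : F} (hβ : β ∈ T) :
    (weightPoly nrm b T i).eval β = if nrm β = b ^ i then 1 else 0 := by
  rw [weightPoly, eval_finsetSum]
  have h : ∀ α ∈ T.filter (fun α => nrm α = b ^ i),
      (Lagrange.basis T id α).eval β = if α = β then 1 else 0 := fun α hα => by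
    split_ifs with hab
    · subst hab
      exact Lagrange.eval_basis_self (v := id) Function.injective_id.injOn hβ
    · exact Lagrange.eval_basis_of_ne (v := id) hab hβ
  rw [Finset.sum_congr rfl h, Finset.sum_ite_eq']
  simp [hβ]

namespace IsPureOperator

variable {nrm : F →*₀ ℝ} {b : ℝ} {N A : Module.End F V} (h : IsPureOperator nrm b N A)
  {T : Finset F}

theorem zpow_injective (h : IsPureOperator nrm b N A) {i j : ℤ} (hij : b ^ i = b ^ j) : i = j :=
  zpow_right_injective₀ (zero_lt_one.trans h.one_lt) h.one_lt.ne' hij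

open Classical in
/-- `weightPoly` of `A` projects onto the sum of the eigenspaces of weight `i`. -/
theorem aeval_weightPoly_apply (hT : ∀ α, A.HasEigenvalue α → α ∈ T) (i : ℤ) {α : F} {x : V}
    (hx : A x = α • x) :
    aeval A (weightPoly nrm b T i) x = if nrm α = b ^ i then x else 0 := by
  by_cases h0 : x = 0
  · simp [h0]
  have hv : A.HasEigenvector α x := ⟨Module.End.mem_eigenspace_iff.2 hx, h0⟩
  rw [Module.End.aeval_apply_of_hasEigenvector hv,
    eval_weightPoly nrm b i (hT α (Module.End.hasEigenvalue_of_hasEigenvector hv))]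
  split_ifs <;> simp

variable [IsAlgClosed F] [FiniteDimensional F V]

theorem mem_of_forall_eigenvector (h : IsPureOperator nrm b N A) {S : Submodule F V}
    (hS : ∀ (α : F) (x : V), A x = α • x → x ∈ S) (x : V) : x ∈ S := by
  have hle : ⨆ μ : F, A.eigenspace μ ≤ S :=
    iSup_le fun μ x hx => hS μ x (Module.End.mem_eigenspace_iff.1 hx)
  rw [h.isSemisimple.iSup_eigenspace_eq_top] at hle
  exact hle trivial

theorem eq_of_forall_eigenvector (h : IsPureOperator nrm b N A) {f g : Module.End F V}
    (hfg : ∀ (α : F) (x : V), A x = α • x → x ≠ 0 → f x = g x) : f = g := by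
  refine LinearMap.ext fun x => h.mem_of_forall_eigenvector (S := LinearMap.eqLocus f g) ?_ x
  intro α x hx
  by_cases h0 : x = 0
  · rw [h0]; exact Submodule.zero_mem _
  · exact hfg α x hx h0

theorem aeval_weightPoly_mul_self (h : IsPureOperator nrm b N A)
    (hT : ∀ α, A.HasEigenvalue α → α ∈ T) (i : ℤ) :
    aeval A (weightPoly nrm b T i) * aeval A (weightPoly nrm b T i) =
      aeval A (weightPoly nrm b T i) := by
  refine h.eq_of_forall_eigenvector fun α x hx _ => ?_
  rw [Module.End.mul_apply, aeval_weightPoly_apply hT i hx]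
  split_ifs with hi
  · rw [aeval_weightPoly_apply hT i hx, if_pos hi]
  · rw [map_zero]

theorem N_mul_aeval_weightPoly (h : IsPureOperator nrm b N A)
    (hT : ∀ α, A.HasEigenvalue α → α ∈ T) (i : ℤ) :
    N * aeval A (weightPoly nrm b T i) = aeval A (weightPoly nrm b T (i - 2)) * N := by
  obtain ⟨a, ha, hna⟩ := h.mul_eq_smul
  refine h.eq_of_forall_eigenvector fun α x hx _ => ?_
  have hb : b ≠ 0 := (zero_lt_one.trans h.one_lt).ne'
  have hNx : A (N x) = (a * α) • N x := by
    have := LinearMap.congr_fun ha x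
    rw [Module.End.mul_apply] at this
    rw [this, LinearMap.smul_apply, Module.End.mul_apply, hx, map_smul, smul_smul]
  rw [Module.End.mul_apply, Module.End.mul_apply, aeval_weightPoly_apply hT i hx,
    aeval_weightPoly_apply hT _ hNx, map_mul, hna, sub_eq_neg_add, zpow_add₀ hb]
  simp only [mul_right_inj' (zpow_ne_zero (-2) hb)]
  split_ifs <;> simp

theorem aeval_weightPoly_apply_mem (h : IsPureOperator nrm b N A)
    (hT : ∀ α, A.HasEigenvalue α → α ∈ T) (i : ℤ) (x : V) :
    aeval A (weightPoly nrm b T i) x ∈ monodromyFil N i := by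
  obtain ⟨n, hn⟩ := h.isNilpotent
  refine h.mem_of_forall_eigenvector
    (S := (monodromyFil N i).comap (aeval A (weightPoly nrm b T i))) (fun α x hx => ?_) x
  rw [Submodule.mem_comap, aeval_weightPoly_apply hT i hx]
  split_ifs with hi
  · by_cases h0 : x = 0
    · rw [h0]; exact Submodule.zero_mem _
    · obtain ⟨k, -, hk, hk'⟩ := exists_mem_notMem_monodromyFil hn h0
      rw [h.weight k α x hx hk hk'] at hi
      rwa [← h.zpow_injective hi]
  · exact Submodule.zero_mem _

/-- `N ^ i` is injective on the part of weight `i > 0`: an eigenvector of this weight in `ker N ^ i`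
would lie in `M_{i-1}`, where all weights are smaller. -/
theorem eq_zero_of_aeval_weightPoly_eq (h : IsPureOperator nrm b N A)
    (hT : ∀ α, A.HasEigenvalue α → α ∈ T) (i : ℕ) {x : V}
    (hx : aeval A (weightPoly nrm b T i) x = x) (hNx : (N ^ i) x = 0) : x = 0 := by
  obtain ⟨n, hn⟩ := h.isNilpotent
  rcases i with _ | m
  · simpa using hNx
  by_contra hx0
  obtain ⟨a, ha, hna⟩ := h.mul_eq_smul
  have ha0 : a ≠ 0 := by
    rintro rfl
    rw [map_zero] at hna
    exact zpow_ne_zero _ (zero_lt_one.trans h.one_lt).ne' hna.symm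
  let S : Submodule F V := LinearMap.eqLocus (aeval A (weightPoly nrm b T ((m + 1 : ℕ) : ℤ))) 1 ⊓
    LinearMap.ker (N ^ (m + 1))
  have hS : ∀ y ∈ S, A y ∈ S := by
    rintro y ⟨hy1, hy2⟩
    constructor
    · have hc : Commute (aeval A (weightPoly nrm b T ((m + 1 : ℕ) : ℤ))) A := by
        simpa using (Commute.all (weightPoly nrm b T ((m + 1 : ℕ) : ℤ)) X).map (aeval A)
      have h1 := LinearMap.congr_fun hc.eq y
      rw [Module.End.mul_apply, Module.End.mul_apply, show _ = y from hy1] at h1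
      exact h1
    · have h1 := LinearMap.congr_fun (mul_pow_of_mul_eq_smul ha (m + 1)) y
      rw [Module.End.mul_apply, LinearMap.mem_ker.1 hy2, map_zero] at h1
      exact (smul_eq_zero.1 h1.symm).resolve_left (pow_ne_zero _ ha0)
  have : Nontrivial S := ⟨⟨⟨x, hx, hNx⟩, 0, fun h0 => hx0 (congrArg Subtype.val h0)⟩⟩
  obtain ⟨μ, hμ⟩ := Module.End.exists_eigenvalue (A.restrict hS)
  obtain ⟨y, hy, hy0⟩ := hμ.exists_hasEigenvector
  have hAy : A y = μ • (y : V) := congrArg Subtype.val (Module.End.mem_eigenspace_iff.1 hy)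
  have hy0' : (y : V) ≠ 0 := fun h0 => hy0 (Subtype.ext h0)
  have hEy := aeval_weightPoly_apply (nrm := nrm) (b := b) hT ((m + 1 : ℕ) : ℤ) hAy
  rw [show aeval A (weightPoly nrm b T ((m + 1 : ℕ) : ℤ)) (y : V) = y from y.2.1] at hEy
  obtain ⟨k, -, hk, hk'⟩ := exists_mem_notMem_monodromyFil hn hy0'
  split_ifs at hEy with hi
  · rw [h.weight k μ y hAy hk hk'] at hi
    refine hk' ?_
    rw [h.zpow_injective hi]
    simpa using ker_pow_le_monodromyFil N m y.2.2
  · exact hy0' hEy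

/-- The grading by weights is a Lefschetz grading; `T` is any finite set that contains the
eigenvalues of `A`. -/
def lefschetzGrading (h : IsPureOperator nrm b N A)
    (hT : ∀ α, A.HasEigenvalue α → α ∈ T) : LefschetzGrading N where
  E i := aeval A (weightPoly nrm b T i)
  bound := h.isNilpotent.choose
  mul_self := h.aeval_weightPoly_mul_self hT
  mul_of_ne i j hij := by
    refine h.eq_of_forall_eigenvector fun α x hx _ => ?_
    rw [Module.End.mul_apply, aeval_weightPoly_apply hT j hx, LinearMap.zero_apply]
    split_ifs with hj
    · rw [aeval_weightPoly_apply hT i hx, if_neg fun hi => hij (h.zpow_injective (hi.symm.trans hj))]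
    · rw [map_zero]
  eq_zero i hi := by
    refine h.eq_of_forall_eigenvector fun α x hx h0 => ?_
    obtain ⟨k, hkn, hk, hk'⟩ := exists_mem_notMem_monodromyFil h.isNilpotent.choose_spec h0
    rw [aeval_weightPoly_apply hT i hx, LinearMap.zero_apply, if_neg]
    rw [h.weight k α x hx hk hk']
    intro hki
    rw [h.zpow_injective hki] at hkn
    omega
  sum_eq_one := by
    refine h.eq_of_forall_eigenvector fun α x hx h0 => ?_
    obtain ⟨k, hkn, hk, hk'⟩ := exists_mem_notMem_monodromyFil h.isNilpotent.choose_spec h0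
    rw [LinearMap.sum_apply, Finset.sum_eq_single k, aeval_weightPoly_apply hT k hx,
      if_pos (h.weight k α x hx hk hk'), Module.End.one_apply]
    · intro i _ hik
      rw [aeval_weightPoly_apply hT i hx, h.weight k α x hx hk hk', if_neg]
      exact fun hki => hik (h.zpow_injective hki).symm
    · intro hk
      exact absurd (Finset.mem_Icc.2 (abs_le.1 hkn)) hk
  N_mul := h.N_mul_aeval_weightPoly hT
  inj i _ hx hNx := h.eq_zero_of_aeval_weightPoly_eq hT i hx hNx
  surj i y hy := by
    obtain ⟨z, rfl⟩ := monodromyFil_le_range N i (hy ▸ h.aeval_weightPoly_apply_mem hT (-i) y)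
    refine ⟨aeval A (weightPoly nrm b T i) z, ?_, ?_⟩
    · exact LinearMap.congr_fun (h.aeval_weightPoly_mul_self hT i) z
    · rw [← Module.End.mul_apply, pow_mul_of_forall_mul (h.N_mul_aeval_weightPoly hT)]
      rw [show (i : ℤ) - 2 * i = -i by ring]
      exact hy

end IsPureOperator

end Weights

/-! ### Absolute values of Weil numbers -/

section Embedding

open Cardinal

variable (p : ℕ) [Fact p.Prime]

theorem mk_padic : #ℚ_[p] = 𝔠 := by
  have hle := continuum_le_cardinal_of_nontriviallyNormedField ℚ_[p]
  have hunc : ¬ Countable ℚ_[p] := by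
    rw [← mk_le_aleph0_iff, not_le]
    exact aleph0_lt_continuum.trans_le hle
  have hR : ¬ Countable ℝ := by
    rw [← mk_le_aleph0_iff, not_le, mk_real]
    exact aleph0_lt_continuum
  borelize ℚ_[p]
  rw [← mk_real]
  exact Cardinal.mk_congr (PolishSpace.measurableEquivOfNotCountable hunc hR).toEquiv

theorem nonempty_padicAlgCl_ringEquiv_complex : Nonempty (PadicAlgCl p ≃+* ℂ) := by
  have hcard : #(PadicAlgCl p) = 𝔠 := by
    refine le_antisymm ?_ ?_
    · refine (Algebra.IsAlgebraic.cardinalMk_le_max ℚ_[p] (PadicAlgCl p)).trans ?_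
      rw [mk_padic, max_eq_left aleph0_le_continuum]
    · rw [← mk_padic p]
      exact mk_le_of_injective (algebraMap ℚ_[p] (PadicAlgCl p)).injective
  refine IsAlgClosed.ringEquiv_of_equiv_of_charZero ?_ ?_
  · rw [hcard]; exact aleph0_lt_continuum
  · rw [← Cardinal.eq, hcard, mk_complex]

variable {p}

/-- The absolute value on `ℚ̄_p` obtained from a field embedding into `ℂ`. -/
def embNorm (ι : PadicAlgCl p →+* ℂ) : PadicAlgCl p →*₀ ℝ :=
  (normHom : ℂ →*₀ ℝ).comp ι.toMonoidWithZeroHom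

theorem embNorm_apply (ι : PadicAlgCl p →+* ℂ) (x : PadicAlgCl p) : embNorm ι x = ‖ι x‖ := rfl

theorem embNorm_natCast (ι : PadicAlgCl p →+* ℂ) (q : ℕ) : embNorm ι q = q := by
  simp [embNorm_apply]

theorem embNorm_eq_sqrt (ι : PadicAlgCl p →+* ℂ) {q : ℕ} {s : PadicAlgCl p} (hs : s ^ 2 = q) :
    embNorm ι s = √q := by
  rw [← embNorm_natCast ι q, ← hs, map_pow, Real.sqrt_sq]
  rw [embNorm_apply]
  exact norm_nonneg (ι s)

theorem IsWeilNumber.embNorm_eq {q : ℕ} {w : ℤ} {α : PadicAlgCl p} (h : IsWeilNumber q w α)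
    (ι : PadicAlgCl p →+* ℂ) : embNorm ι α = √q ^ w := by
  have h1 := h.2 (ι α) (by
    rw [← ι.toRatAlgHom_apply, Polynomial.aeval_algHom_apply, minpoly.aeval, map_zero])
  rw [embNorm_apply, h1, Real.sqrt_eq_rpow, ← Real.rpow_intCast, ← Real.rpow_mul (by positivity)]
  congr 1
  ring

end Embedding

theorem one_lt_resCard {ℓ : ℕ} [Fact ℓ.Prime] {K : Type*} [Field K] [Algebra ℚ_[ℓ] K]
    [FiniteDimensional ℚ_[ℓ] K] : 1 < resCard ℓ K := Finite.one_lt_card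

/-! ### Frobenius powers in representations of the Weil group -/

section WeilGroup

open scoped Topology

variable {ℓ : ℕ} [Fact ℓ.Prime] {K : Type*} [Field K] [Algebra ℚ_[ℓ] K] [FiniteDimensional ℚ_[ℓ] K]
  {M : Type*} [Monoid M]

/-- Some power of a Frobenius lift acts centrally. -/
theorem exists_pow_commute_all (r : weilGroup ℓ K →* M)
    (hr : IsOpen[weilTopology ℓ K] (r.ker : Set (weilGroup ℓ K))) (φ : FrobLift ℓ K) :
    ∃ n : ℕ, 0 < n ∧ ∀ g, Commute (r g) (r φ.1 ^ n) := by
  have hfin := finite_range_inertia r hr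
  have hex : ∀ m ∈ hfin.toFinset, ∃ n : ℕ, 0 < n ∧ Commute m (r φ.1 ^ n) := by
    intro m hm
    obtain ⟨i, rfl⟩ : ∃ i, r (inertiaEmb ℓ K i) = m := by simpa using hm
    exact exists_pow_commute r hr φ.1 _ (val_inertiaEmb i)
  choose! c hc0 hc using hex
  have hn : ∀ m ∈ hfin.toFinset, Commute m (r φ.1 ^ ∏ m ∈ hfin.toFinset, c m) := by
    intro m hm
    obtain ⟨d, hd⟩ := Finset.dvd_prod_of_mem c hm
    rw [hd, pow_mul]
    exact (hc m hm).pow_right d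
  refine ⟨∏ m ∈ hfin.toFinset, c m, Finset.prod_pos hc0, fun g => ?_⟩
  have h0 : val (g * φ.1 ^ (-val g)) = 0 := by
    rw [val_mul, val_zpow, φ.2]; ring
  have h1 := hn (r (g * φ.1 ^ (-val g)))
    (by rw [Set.Finite.mem_toFinset]; exact ⟨⟨_, (val_eq_zero_iff _).1 h0⟩, rfl⟩)
  have e : g = (g * φ.1 ^ (-val g)) * φ.1 ^ val g := by group
  rw [e, map_mul]
  refine h1.mul_left ?_
  rw [← map_pow]
  exact (((Commute.refl φ.1).zpow_left _).pow_right _).map r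

/-- The image of the Weil group is finite modulo a power of Frobenius: representatives are the
products of finitely many elements of inertia with `φ ^ j`, `0 ≤ j < n`. -/
theorem exists_finite_mod_frobenius_pow (r : weilGroup ℓ K →* M)
    (hr : IsOpen[weilTopology ℓ K] (r.ker : Set (weilGroup ℓ K))) (φ : FrobLift ℓ K)
    {n : ℕ} (hn : 0 < n) : ∃ T : Set (weilGroup ℓ K), T.Finite ∧
      ∀ g, ∃ t ∈ T, ∃ k : ℤ, r g = r (t * (φ.1 ^ n) ^ k) := by
  have hfin := finite_range_inertia r hr
  have hex : ∀ m ∈ hfin.toFinset, ∃ i, r (inertiaEmb ℓ K i) = m := by simp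
  choose! c hc using hex
  refine ⟨Set.image2 (fun m j => inertiaEmb ℓ K (c m) * φ.1 ^ j) hfin.toFinset
    (Finset.range n : Set ℕ), (Finset.finite_toSet _).image2 _ (Finset.finite_toSet _),
    fun g => ?_⟩
  have h0 : val (g * φ.1 ^ (-val g)) = 0 := by
    rw [val_mul, val_zpow, φ.2]; ring
  have hm : r (g * φ.1 ^ (-val g)) ∈ hfin.toFinset := by
    rw [Set.Finite.mem_toFinset]; exact ⟨⟨_, (val_eq_zero_iff _).1 h0⟩, rfl⟩
  have hn' : (0 : ℤ) < n := by exact_mod_cast hn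
  have hmod : ((val g % n).toNat : ℤ) = val g % n := Int.toNat_of_nonneg (Int.emod_nonneg _ hn'.ne')
  refine ⟨_, ⟨_, hm, (val g % n).toNat, ?_, rfl⟩, val g / n, ?_⟩
  · have := Int.emod_lt_of_pos (val g) hn'
    simp only [Finset.coe_range, Set.mem_Iio]
    omega
  · have e : φ.1 ^ (val g % n).toNat * (φ.1 ^ n) ^ (val g / n) = φ.1 ^ val g := by
      rw [← zpow_natCast, ← zpow_natCast, ← zpow_mul, ← zpow_add, hmod, Int.emod_add_mul_ediv]
    rw [mul_assoc, e, map_mul, hc _ hm, ← map_mul]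
    congr 1
    group

end WeilGroup

/-! ### Traces and unipotent operators -/

section Unipotent

theorem isNilpotent_units_zpow_sub_one {A : Type*} [Ring A] {u : Aˣ}
    (hu : IsNilpotent ((u : A) - 1)) (n : ℤ) : IsNilpotent (((u ^ n : Aˣ) : A) - 1) := by
  obtain ⟨k, rfl | rfl⟩ := n.eq_nat_or_neg
  · rw [zpow_natCast, Units.val_pow_eq_pow_val]
    exact isNilpotent_pow_sub_one hu k
  · rw [zpow_neg, zpow_natCast]
    have e : ((u ^ k)⁻¹ : Aˣ) - (1 : A) = -(((u ^ k)⁻¹ : Aˣ) * (((u ^ k : Aˣ) : A) - 1)) := by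
      rw [mul_sub, Units.inv_mul]; noncomm_ring
    rw [e]
    have hc : Commute (((u ^ k)⁻¹ : Aˣ) : A) (((u ^ k : Aˣ) : A) - 1) :=
      (Commute.units_inv_left (Commute.refl _)).sub_right (Commute.one_right _)
    refine (hc.isNilpotent_mul_left ?_).neg
    rw [Units.val_pow_eq_pow_val]
    exact isNilpotent_pow_sub_one hu k

variable {F V : Type*} [Field F] [AddCommGroup V] [Module F V]

theorem trace_mul_eq_of_isNilpotent_sub_one [FiniteDimensional F V] {f u : Module.End F V}
    (h : Commute f u) (hu : IsNilpotent (u - 1)) :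
    LinearMap.trace F V (f * u) = LinearMap.trace F V f := by
  have h1 : IsNilpotent (f * (u - 1)) :=
    (h.sub_right (Commute.one_right _)).isNilpotent_mul_left hu
  have h2 := (LinearMap.isNilpotent_trace_of_isNilpotent h1).eq_zero
  rwa [mul_sub, mul_one, map_sub, sub_eq_zero] at h2

/-- A nilpotent operator that preserves `M` moves a vector outside `L` to a vector outside `L` that
it maps into `L`. -/
theorem exists_pow_apply_notMem {X : Module.End F V} (hX : IsNilpotent X) {L : Submodule F V}
    {x : V} (hx : x ∉ L) : ∃ m : ℕ, (X ^ m) x ∉ L ∧ (X ^ (m + 1)) x ∈ L := by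
  classical
  have hex : ∃ m, (X ^ m) x ∈ L := by
    obtain ⟨m, hm⟩ := hX
    exact ⟨m, by rw [hm]; exact L.zero_mem⟩
  have h0 : Nat.find hex ≠ 0 := fun h => hx (by simpa [h] using Nat.find_spec hex)
  obtain ⟨m, hm⟩ := Nat.exists_eq_succ_of_ne_zero h0
  exact ⟨m, Nat.find_min hex (by omega), by rw [← Nat.succ_eq_add_one, ← hm]; exact Nat.find_spec hex⟩

theorem commute_aeval_right {f g : Module.End F V} (h : Commute f g) (Q : Polynomial F) :
    Commute f (Polynomial.aeval g Q) :=
  (Algebra.commute_of_mem_adjoin_singleton_of_commute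
    (Polynomial.aeval_mem_adjoin_singleton F g) h)

theorem trace_mul_aeval_eq {W V' : Type*} [Group W] [AddCommGroup V'] [Module F V']
    {ρ : Representation F W V} {ρ' : Representation F W V'}
    (h : ∀ g, LinearMap.trace F V (ρ g) = LinearMap.trace F V' (ρ' g)) (g z : W)
    (Q : Polynomial F) :
    LinearMap.trace F V (ρ g * Polynomial.aeval (ρ z) Q) =
      LinearMap.trace F V' (ρ' g * Polynomial.aeval (ρ' z) Q) := by
  induction Q using Polynomial.induction_on' with
  | add Q R hQ hR => simp only [map_add, mul_add, hQ, hR]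
  | monomial n a =>
    rw [Polynomial.aeval_monomial, Polynomial.aeval_monomial, ← Algebra.smul_def,
      ← Algebra.smul_def, mul_smul_comm, mul_smul_comm, map_smul, map_smul, ← map_pow, ← map_pow,
      ← map_mul, ← map_mul, h]

end Unipotent

/-! ### Frobenius eigenvalues of pure representations -/

namespace WeilDeligneRep

variable {ℓ : ℕ} [Fact ℓ.Prime] {K : Type*} [Field K] [Algebra ℚ_[ℓ] K] [FiniteDimensional ℚ_[ℓ] K]
  {p : ℕ} [Fact p.Prime] {V : Type*} [AddCommGroup V] [Module (PadicAlgCl p) V]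

theorem grMap_mk (D : WeilDeligneRep ℓ K p V) (k : ℤ) (σ : weilGroup ℓ K)
    (x : D.monodromyFiltration k) :
    D.grMap k σ (Submodule.Quotient.mk x) =
      Submodule.Quotient.mk ⟨D.r σ x, D.monodromyFiltration_le_comap σ k x.2⟩ := rfl

theorem grMap_pow (D : WeilDeligneRep ℓ K p V) (k : ℤ) (σ : weilGroup ℓ K) (n : ℕ) :
    D.grMap k (σ ^ n) = D.grMap k σ ^ n := by
  induction n with
  | zero =>
    refine LinearMap.ext fun x => ?_
    obtain ⟨x, rfl⟩ := Submodule.Quotient.mk_surjective _ x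
    rw [grMap_mk]
    simp
  | succ n ih =>
    rw [pow_succ' σ, pow_succ' (D.grMap k σ), ← ih]
    refine LinearMap.ext fun x => ?_
    obtain ⟨x, rfl⟩ := Submodule.Quotient.mk_surjective _ x
    rw [Module.End.mul_apply, grMap_mk, grMap_mk, grMap_mk]
    simp

variable [FiniteDimensional (PadicAlgCl p) V]

theorem frobSS_r (D : WeilDeligneRep ℓ K p V) (φ : FrobLift ℓ K) (g : weilGroup ℓ K) :
    (D.frobSS φ).r g = D.r g * ↑(D.frobUnipotent φ ^ (-val g)) := rfl

theorem psiTwist_r {V : Type*} [AddCommGroup V] [Module (PadicAlgCl p) V]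
    (D : WeilDeligneRep ℓ K p V) (s : (PadicAlgCl p)ˣ) (n : ℤ) (g : weilGroup ℓ K) :
    (D.psiTwist s n).r g = (((s ^ val g) ^ n : (PadicAlgCl p)ˣ) : PadicAlgCl p) • D.r g := rfl

theorem commute_r_frobUnipotent_zpow (D : WeilDeligneRep ℓ K p V) (φ : FrobLift ℓ K)
    (g : weilGroup ℓ K) (n : ℤ) :
    Commute (D.r g) (↑(D.frobUnipotent φ ^ n) : Module.End (PadicAlgCl p) V) := by
  have h5 : Commute (D.r.toHomUnits g) (D.frobUnipotent φ) :=
    Units.ext (D.commute_r_frobUnipotent φ g)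
  exact congrArg Units.val (h5.zpow_right n)

theorem trace_frobSS_psiTwist (D : WeilDeligneRep ℓ K p V) (φ : FrobLift ℓ K)
    (s : (PadicAlgCl p)ˣ) (w : ℤ) (g : weilGroup ℓ K) :
    LinearMap.trace _ V (((D.frobSS φ).psiTwist s (-w)).r g) = D.normalizedTrace s w g := by
  obtain ⟨-, -, -, -, hu⟩ := D.frobUnipotent_spec φ
  rw [normalizedTrace, psiTwist_r, psiTwist_r, frobSS_r, map_smul, map_smul,
    trace_mul_eq_of_isNilpotent_sub_one (D.commute_r_frobUnipotent_zpow φ g _)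
      (isNilpotent_units_zpow_sub_one hu _)]

theorem isSemisimple_frobSS_r (D : WeilDeligneRep ℓ K p V) (φ : FrobLift ℓ K) (n : ℕ) :
    Module.End.IsSemisimple ((D.frobSS φ).r (φ.1 ^ n)) := by
  obtain ⟨s, hs, -, hss, -⟩ := D.frobUnipotent_spec φ
  have h : (D.frobSS φ).r φ.1 = s := by
    rw [frobSS_r, φ.2, hs, zpow_neg, zpow_one, Units.mul_inv_cancel_right]
  rw [map_pow, h]
  exact hss.pow n

/-- Eigenvalues of a power of the semisimple part of Frobenius on the graded pieces of the monodromy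
filtration are powers of eigenvalues of Frobenius. -/
theorem exists_hasEigenvalue_grMap (D : WeilDeligneRep ℓ K p V) (φ : FrobLift ℓ K) {n : ℕ}
    (hn : 0 < n) {k : ℤ} {μ : PadicAlgCl p} {x : V} (hx : (D.frobSS φ).r (φ.1 ^ n) x = μ • x)
    (hk : x ∈ D.monodromyFiltration k) (hk' : x ∉ D.monodromyFiltration (k - 1)) :
    ∃ α, (D.grMap k φ.1).HasEigenvalue α ∧ α ^ n = μ := by
  obtain ⟨-, -, -, -, hu⟩ := D.frobUnipotent_spec φ
  set u : Module.End (PadicAlgCl p) V := ↑(D.frobUnipotent φ ^ n) with hu'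
  have hunil : IsNilpotent (u - 1) := by
    have := isNilpotent_units_zpow_sub_one hu n
    rwa [zpow_natCast] at this
  set A := (D.frobSS φ).r (φ.1 ^ n) with hA
  have hDA : D.r (φ.1 ^ n) = A * u := by
    have hval : val (φ.1 ^ n) = n := by rw [← zpow_natCast, val_zpow, φ.2, mul_one]
    rw [hA, frobSS_r, hval, hu', zpow_neg, zpow_natCast, Units.inv_mul_cancel_right]
  have hAu : Commute A u := by
    rw [hA, frobSS_r]
    refine Commute.mul_left ?_ ?_
    · rw [hu', ← zpow_natCast (D.frobUnipotent φ)]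
      exact D.commute_r_frobUnipotent_zpow φ _ _
    · rw [hu', ← zpow_natCast (D.frobUnipotent φ)]
      exact congrArg Units.val
        ((Commute.refl (D.frobUnipotent φ)).zpow_zpow (-val (φ.1 ^ n)) (n : ℤ))
  have huN : Commute (u - 1) D.N := by
    refine Commute.sub_left ?_ (Commute.one_left _)
    rw [hu', Units.val_pow_eq_pow_val]
    exact (D.commute_frobUnipotent_N φ).pow_left n
  obtain ⟨m, hm, hm'⟩ := exists_pow_apply_notMem hunil hk'
  -- `y` is fixed by `u` modulo `M_{k-1}`, hence it is an eigenvector of `φ ^ n` on the graded piece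
  set y := ((u - 1) ^ m) x with hy
  have hyk : y ∈ D.monodromyFiltration k := apply_mem_monodromyFil (huN.pow_left m) hk
  have hAy : A y = μ • y := by
    have hc : Commute A ((u - 1) ^ m) := (hAu.sub_right (Commute.one_right _)).pow_right m
    have := LinearMap.congr_fun hc.eq x
    rw [Module.End.mul_apply, Module.End.mul_apply, hx, map_smul] at this
    exact this
  have hDy : D.r (φ.1 ^ n) y - μ • y ∈ D.monodromyFiltration (k - 1) := by
    have e : D.r (φ.1 ^ n) y - μ • y = (D.frobSS φ).r (φ.1 ^ n) (((u - 1) ^ (m + 1)) x) := by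
      rw [pow_succ', Module.End.mul_apply, ← hy, ← hA, hDA, Module.End.mul_apply,
        LinearMap.sub_apply, map_sub, Module.End.one_apply, hAy]
    rw [e]
    exact (D.frobSS φ).monodromyFiltration_le_comap _ _ hm'
  have hev : (D.grMap k φ.1 ^ n).HasEigenvalue μ := by
    rw [← grMap_pow]
    refine Module.End.hasEigenvalue_of_hasEigenvector
      (x := Submodule.Quotient.mk (⟨y, hyk⟩ : D.monodromyFiltration k))
      ⟨Module.End.mem_eigenspace_iff.2 ?_, ?_⟩
    · rw [grMap_mk, ← Submodule.Quotient.mk_smul, Submodule.Quotient.eq]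
      exact hDy
    · rw [Ne, Submodule.Quotient.mk_eq_zero]
      exact hm
  rw [Module.End.hasEigenvalue_iff_mem_spectrum, spectrum.map_pow_of_pos _ hn] at hev
  obtain ⟨α, hα, hαμ⟩ := hev
  exact ⟨α, Module.End.hasEigenvalue_iff_mem_spectrum.2 hα, hαμ⟩

/-- After normalization to weight `0`, the `n`-th power of the semisimple part of Frobenius acts with
eigenvalues of absolute value `(q ^ (n / 2)) ^ k` on the `k`-th graded piece. -/
theorem IsPure.isPureOperator {D : WeilDeligneRep ℓ K p V} {φ : FrobLift ℓ K} {w : ℤ}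
    (h : D.IsPure φ w) {s : (PadicAlgCl p)ˣ} (hs : (s : PadicAlgCl p) ^ 2 = resCard ℓ K)
    {n : ℕ} (hn : 0 < n) (ι : PadicAlgCl p →+* ℂ) :
    IsPureOperator (embNorm ι) (√(resCard ℓ K) ^ n) D.N
      (((D.frobSS φ).psiTwist s (-w)).r (φ.1 ^ n)) := by
  have hq1 : (1 : ℝ) < resCard ℓ K := by exact_mod_cast one_lt_resCard
  have hb : 1 < √(resCard ℓ K : ℝ) := by rwa [Real.lt_sqrt zero_le_one, one_pow]
  have hb0 : √(resCard ℓ K : ℝ) ≠ 0 := (zero_lt_one.trans hb).ne'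
  have hval : val (φ.1 ^ n) = n := by rw [← zpow_natCast, val_zpow, φ.2, mul_one]
  refine ⟨?_, D.isNilpotent_N, one_lt_pow₀ hb hn.ne', ?_, ?_⟩
  · rw [psiTwist_r]
    exact Module.End.IsSemisimple_smul _ (D.isSemisimple_frobSS_r φ n)
  · refine ⟨_, ((D.frobSS φ).psiTwist s (-w)).r_mul_N (φ.1 ^ n), ?_⟩
    have hsq : (resCard ℓ K : ℝ) = √(resCard ℓ K) ^ (2 : ℤ) :=
      (Real.sq_sqrt (zero_le_one.trans hq1.le)).symm
    rw [hval, map_zpow₀, embNorm_natCast]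
    conv_lhs => rw [hsq]
    rw [← zpow_natCast, ← zpow_mul, ← zpow_mul]
    congr 1
    ring
  · intro k μ x hx hk hk'
    rw [psiTwist_r, hval] at hx
    set c : (PadicAlgCl p)ˣ := (s ^ (n : ℤ)) ^ (-w) with hc
    have hx' : (D.frobSS φ).r (φ.1 ^ n) x = ((c⁻¹ : (PadicAlgCl p)ˣ) * μ) • x := by
      rw [mul_smul, ← hx, LinearMap.smul_apply, smul_smul, Units.inv_mul, one_smul]
    obtain ⟨α, hα, hαμ⟩ := D.exists_hasEigenvalue_grMap φ hn hx' hk hk'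
    have h1 := (h k α hα).embNorm_eq ι
    have h2 : μ = c * α ^ n := by rw [hαμ, ← mul_assoc, Units.mul_inv, one_mul]
    rw [h2, map_mul, map_pow, h1, hc, Units.val_zpow_eq_zpow_val, Units.val_zpow_eq_zpow_val,
      map_zpow₀, map_zpow₀, embNorm_eq_sqrt ι hs]
    simp only [← zpow_natCast, ← zpow_mul]
    rw [← zpow_add₀ hb0]
    congr 1
    ring

end WeilDeligneRep

/-! ### Comparison of two pure representations -/

namespace WeilDeligneRep

variable {ℓ : ℕ} [Fact ℓ.Prime] {K : Type*} [Field K] [Algebra ℚ_[ℓ] K] [FiniteDimensional ℚ_[ℓ] K]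
  {p : ℕ} [Fact p.Prime] {V V' : Type*} [AddCommGroup V] [Module (PadicAlgCl p) V]
  [AddCommGroup V'] [Module (PadicAlgCl p) V']

/-- Weil--Deligne representations with the same trace are isomorphic if the positive powers of a
Frobenius lift act as pure operators. The proof uses a power that acts centrally on both spaces. -/
theorem isIsomorphic_of_trace_eq [FiniteDimensional (PadicAlgCl p) V]
    [FiniteDimensional (PadicAlgCl p) V'] (D : WeilDeligneRep ℓ K p V) (D' : WeilDeligneRep ℓ K p V')
    (φ : FrobLift ℓ K) {nrm : PadicAlgCl p →*₀ ℝ} {b : ℝ}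
    (h : ∀ n : ℕ, 0 < n → IsPureOperator nrm (b ^ n) D.N (D.r (φ.1 ^ n)))
    (h' : ∀ n : ℕ, 0 < n → IsPureOperator nrm (b ^ n) D'.N (D'.r (φ.1 ^ n)))
    (htr : ∀ g, LinearMap.trace _ V (D.r g) = LinearMap.trace _ V' (D'.r g)) :
    D.IsIsomorphic D' := by
  obtain ⟨n₁, hn₁, hc₁⟩ := exists_pow_commute_all D.r D.isOpen_ker φ
  obtain ⟨n₂, hn₂, hc₂⟩ := exists_pow_commute_all D'.r D'.isOpen_ker φ
  have hn : 0 < n₁ * n₂ := Nat.mul_pos hn₁ hn₂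
  set z := φ.1 ^ (n₁ * n₂) with hz
  have hc : ∀ g, Commute (D.r g) (D.r z) := fun g => by
    rw [hz, map_pow, pow_mul]; exact (hc₁ g).pow_right _
  have hc' : ∀ g, Commute (D'.r g) (D'.r z) := fun g => by
    rw [hz, map_pow, mul_comm, pow_mul]; exact (hc₂ g).pow_right _
  -- a common set of interpolation nodes, so that both gradings are given by the same polynomials
  have hfin := (Module.End.finite_spectrum (D.r z)).union (Module.End.finite_spectrum (D'.r z))
  have hT : ∀ α, Module.End.HasEigenvalue (D.r z) α → α ∈ hfin.toFinset := fun α hα =>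
    hfin.mem_toFinset.2 (Or.inl (Module.End.hasEigenvalue_iff_mem_spectrum.1 hα))
  have hT' : ∀ α, Module.End.HasEigenvalue (D'.r z) α → α ∈ hfin.toFinset := fun α hα =>
    hfin.mem_toFinset.2 (Or.inr (Module.End.hasEigenvalue_iff_mem_spectrum.1 hα))
  exact ((h _ hn).lefschetzGrading hT).exists_equiv_of_trace_mul_eq
    ((h' _ hn).lefschetzGrading hT')
    (χ := fun g => (resCard ℓ K : PadicAlgCl p) ^ (-val g))
    (fun g => zpow_ne_zero _ (resCard_ne_zero ℓ K p))
    (fun g i => commute_aeval_right (hc g) _) (fun g i => commute_aeval_right (hc' g) _)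
    D.r_mul_N D'.r_mul_N (h _ hn).isSemisimple (h' _ hn).isSemisimple
    (exists_finite_mod_frobenius_pow D.r D.isOpen_ker φ hn)
    (exists_finite_mod_frobenius_pow D'.r D'.isOpen_ker φ hn)
    (fun g i => trace_mul_aeval_eq htr g z _)

theorem isIsomorphic_psiTwist_sub {D : WeilDeligneRep ℓ K p V} {D' : WeilDeligneRep ℓ K p V'}
    {s : (PadicAlgCl p)ˣ} {a b : ℤ}
    (h : (D.psiTwist s (-a)).IsIsomorphic (D'.psiTwist s (-b))) :
    D.IsIsomorphic (D'.psiTwist s (a - b)) := by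
  obtain ⟨e, he, heN⟩ := h
  refine ⟨e, fun g x => ?_, heN⟩
  have h1 := he g x
  rw [psiTwist_r, psiTwist_r, LinearMap.smul_apply, LinearMap.smul_apply, map_smul] at h1
  rw [psiTwist_r, LinearMap.smul_apply, sub_eq_add_neg, zpow_add, Units.val_mul, mul_smul, ← h1,
    smul_smul, ← Units.val_mul, ← zpow_add, add_neg_cancel, zpow_zero, Units.val_one, one_smul]

end WeilDeligneRep

end LocalField

end

theorem theorem3p1 (p ℓ : ℕ) [Fact p.Prime] [Fact ℓ.Prime] (hpℓ : p ≠ ℓ)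
    (K : Type*) [Field K] [Algebra ℚ_[ℓ] K] [FiniteDimensional ℚ_[ℓ] K]
    -- a lift of the geometric Frobenius, and a square root of `q`
    (φ : LocalField.FrobLift ℓ K)
    (s : (PadicAlgCl p)ˣ) (hs : (s : PadicAlgCl p) ^ 2 = (LocalField.resCard ℓ K : PadicAlgCl p))
    {V₁ V₂ : Type*} [AddCommGroup V₁] [Module (PadicAlgCl p) V₁]
    [FiniteDimensional (PadicAlgCl p) V₁] [AddCommGroup V₂] [Module (PadicAlgCl p) V₂]
    [FiniteDimensional (PadicAlgCl p) V₂]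
    (D₁ : LocalField.WeilDeligneRep ℓ K p V₁) (D₂ : LocalField.WeilDeligneRep ℓ K p V₂)
    (w₁ w₂ : ℤ) (h₁ : D₁.IsPure φ w₁) (h₂ : D₂.IsPure φ w₂)
    (htr : ∀ g, D₁.normalizedTrace s w₁ g = D₂.normalizedTrace s w₂ g) :
    (D₁.frobSS φ).IsIsomorphic ((D₂.frobSS φ).psiTwist s (w₁ - w₂)) := by
  obtain ⟨ι⟩ := LocalField.nonempty_padicAlgCl_ringEquiv_complex p
  apply LocalField.WeilDeligneRep.isIsomorphic_psiTwist_sub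
  refine LocalField.WeilDeligneRep.isIsomorphic_of_trace_eq _ _ φ
    (fun n hn => h₁.isPureOperator hs hn ι.toRingHom)
    (fun n hn => h₂.isPureOperator hs hn ι.toRingHom) fun g => ?_
  rw [LocalField.WeilDeligneRep.trace_frobSS_psiTwist,
    LocalField.WeilDeligneRep.trace_frobSS_psiTwist, htr]
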